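/- **Setting.** Let $G$ be a compact connected Lie group with Lie algebra $\mathfrak g$ and Killing form $B$, and let $H\subset G$ be a compact subgroup with Lie algebra $\mathfrak h$, such that $G/H$ is almost effective ($\mathfrak h$ contains no nonzero ideal of $\mathfrak g$). Fix an $\mathrm{Ad}(G)$-invariant inner product on $\mathfrak g$, let $\mathfrak p$ be the orthogonal complement of $\mathfrak h$, and identify $G$-invariant Riemannian metrics on $G/H$ with $\mathrm{Ad}(H)$-invariant inner products on $\mathfrak p$. Let $\mathcal M_1$ be the set of such inner products of some fixed volume and $S$ the scalar curvature functional. For $(\cdot,\cdot)\in\mathcal M_1$ let $\mathcal T$ be the space of $\mathrm{Ad}(H)$-equivariant, $(\cdot,\cdot)$-symmetric operators on $\mathfrak p$ with zero trace. The metric is a *critical point* of $S$ on $\mathcal M_1$ (equivalently, it is Einstein) if $\frac{d}{dt}\big|_{t=0}S\big((e^{tV}\cdot,\cdot)\big)=0$ for all $V\in\mathcal T$. A critical point is *degenerate* if there is a nonzero $U\in\mathcal T$ with $\frac{\partial^2}{\partial t\,\partial s}\big|_{t=s=0}S\big((e^{tV+sU}\cdot,\cdot)\big)=0$ for all $V\in\mathcal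 T$. A *decomposition* for $(\cdot,\cdot)$ is a decomposition $\mathfrak p=\mathfrak p_1\oplus\dots\oplus\mathfrak p_q$ into pairwise $(\cdot,\cdot)$-orthogonal $\mathrm{Ad}(H)$-irreducible submodules. Put $d_i=\dim\mathfrak p_i$, let $b_i$ be the value of $B$ on a unit vector of $\mathfrak p_i$, and, for $(\cdot,\cdot)$-orthonormal bases $(e_i^\alpha)_\alpha$ of the $\mathfrak p_i$, put $$[k;ij]=\sum_{\alpha,\beta,\gamma}\big([e_i^\alpha,e_j^\beta]_{\mathfrak p},e_k^\gamma\big)^2 .$$ Let $F=(f_{ij})$ be the $q\times q$ matrix with $$f_{ii}=-\frac{b_id_i}{2}-\frac14\sum_{j,k}\big([i;kj]+2[k;ij]\big)-\frac12\sum_j\big([j;ii]-2[i;ij]\big),$$ $$f_{ij}=\frac12\sum_k\big([j;ik]+[i;kj]-[k;ij]\big)\qquad(i\ne j).$$ **Theorem.** Let $(\cdot,\cdot)$ be a critical point of $S$ on $\mathcal M_1$. 1. If $(\cdot,\cdot)$ is a degenerate critical point of $S$ on $\mathcal M_1$, then $F$ is singular for some decomposition. 2. Conversely, suppose $\dim G/H\neq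 1$. If $F$ is singular for some decomposition whose irreducible summands $\mathfrak p_1,\dots,\mathfrak p_q$ are pairwise non-isomorphic as $\mathrm{Ad}(H)$-modules, then $(\cdot,\cdot)$ is a degenerate critical point of $S$ on $\mathcal M_1$. -/

import Mathlib

open scoped Manifold ContDiff

noncomputable section

namespace HomogeneousMetric

/-! ### The scalar curvature of an invariant metric, algebraically

`𝔤` is a Lie algebra, `𝔭` a subspace and `π : 𝔤 → 𝔭` the projection along a complementary
subalgebra `𝔥` with `[𝔥, 𝔭] ⊆ 𝔭`. A symmetric positive definite form `g` on `𝔭` that is invariant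
under the isotropy representation is an invariant Riemannian metric on the homogeneous space. -/

section Curvature

variable {𝔤 : Type*} [LieRing 𝔤] [LieAlgebra ℝ 𝔤] {𝔭 : Submodule ℝ 𝔤}

/-- `bracketP π X Y = [X, Y]_𝔭` for `X ∈ 𝔤` and `Y ∈ 𝔭`. -/
def bracketP (π : 𝔤 →ₗ[ℝ] 𝔭) : 𝔤 →ₗ[ℝ] 𝔭 →ₗ[ℝ] 𝔭 :=
  LinearMap.mk₂ ℝ (fun X (Y : 𝔭) => π ⁅X, (Y : 𝔤)⁆)
    (by intros; simp) (by intros; simp) (by intros; simp) (by intros; simp)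

/-- The map from `1`-forms to vectors given by a nondegenerate form `g`
(the inverse of `x ↦ g x ·`). -/
def sharp {V : Type*} [AddCommGroup V] [Module ℝ V] [FiniteDimensional ℝ V]
    (g : LinearMap.BilinForm ℝ V) : Module.Dual ℝ V →ₗ[ℝ] V :=
  open Classical in
  if h : g.Nondegenerate then (LinearMap.BilinForm.toDual g h).symm.toLinearMap else 0

/-- The right-hand side of the Koszul formula:
`koszul π g X Y Z = (g([X, Y]_𝔭, Z) + g([Z, X]_𝔭, Y) + g(X, [Z, Y]_𝔭)) / 2`. -/
def koszul (π : 𝔤 →ₗ[ℝ] 𝔭) (g : LinearMap.BilinForm ℝ 𝔭) :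
    𝔭 →ₗ[ℝ] 𝔭 →ₗ[ℝ] Module.Dual ℝ 𝔭 :=
  LinearMap.mk₂ ℝ
    (fun X Y =>
      { toFun := fun Z =>
          (g (bracketP π X Y) Z + g (bracketP π Z X) Y + g X (bracketP π Z Y)) / 2
        map_add' := by intros; simp; ring
        map_smul' := by intros; simp; ring })
    (by intros; ext; simp; ring) (by intros; ext; simp; ring)
    (by intros; ext; simp; ring) (by intros; ext; simp; ring)

variable [FiniteDimensional ℝ 𝔤]

/-- The Levi-Civita connection of the invariant metric `g` at the base point, as the operator
`Λ : 𝔭 → End 𝔭`: `g(Λ(X)Y, Z) = koszul π g X Y Z`. It is the only map into the `g`-skew operators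
with `Λ(X)Y - Λ(Y)X = [X, Y]_𝔭`. -/
def leviCivita (π : 𝔤 →ₗ[ℝ] 𝔭) (g : LinearMap.BilinForm ℝ 𝔭) : 𝔭 →ₗ[ℝ] 𝔭 →ₗ[ℝ] 𝔭 :=
  LinearMap.mk₂ ℝ (fun X Y => sharp g (koszul π g X Y))
    (by intros; simp) (by intros; simp) (by intros; simp) (by intros; simp)

/-- The curvature tensor at the base point:
`R(X, Y)Z = Λ(X)Λ(Y)Z - Λ(Y)Λ(X)Z - Λ([X, Y]_𝔭)Z - [[X, Y]_𝔥, Z]`. -/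
def curvature (π : 𝔤 →ₗ[ℝ] 𝔭) (g : LinearMap.BilinForm ℝ 𝔭) :
    𝔭 →ₗ[ℝ] 𝔭 →ₗ[ℝ] 𝔭 →ₗ[ℝ] 𝔭 :=
  LinearMap.mk₂ ℝ
    (fun X Y =>
      leviCivita π g X ∘ₗ leviCivita π g Y - leviCivita π g Y ∘ₗ leviCivita π g X
        - leviCivita π g (bracketP π X Y)
        - bracketP π (⁅(X : 𝔤), (Y : 𝔤)⁆ - (π ⁅(X : 𝔤), (Y : 𝔤)⁆ : 𝔤)))
    (by intros; ext; simp; abel)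
    (by intros; ext; simp [smul_sub])
    (by intros; ext; simp; abel)
    (by intros; ext; simp [smul_sub])

/-- The Ricci curvature `Ric(Y, Z) = trace (X ↦ R(X, Y)Z)`. -/
def ricci (π : 𝔤 →ₗ[ℝ] 𝔭) (g : LinearMap.BilinForm ℝ 𝔭) : LinearMap.BilinForm ℝ 𝔭 :=
  LinearMap.mk₂ ℝ
    (fun Y Z => LinearMap.trace ℝ 𝔭 (((curvature π g).flip Y).flip Z))
    (by intros; rw [← map_add]; congr 1; ext; simp)
    (by intros; rw [← map_smul]; congr 1; ext; simp)
    (by intros; simp)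
    (by intros; simp)

/-- The scalar curvature: the trace of the Ricci curvature with respect to `g`. -/
def scalarCurvature (π : 𝔤 →ₗ[ℝ] 𝔭) (g : LinearMap.BilinForm ℝ 𝔭) : ℝ :=
  LinearMap.trace ℝ 𝔭 (sharp g ∘ₗ ricci π g)

end Curvature

/-! ### Invariant inner products of fixed volume and their critical points -/

section Metrics

variable {K : Type*} [Group K] {V : Type*} [AddCommGroup V] [Module ℝ V] [FiniteDimensional ℝ V]

/-- An inner product invariant under the representation `ρ`. -/
structure IsInvariantInner (ρ : Representation ℝ K V) (g : LinearMap.BilinForm ℝ V) : Prop where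
  symm : ∀ x y, g x y = g y x
  pos : ∀ x, x ≠ 0 → 0 < g x x
  inv : ∀ k x y, g (ρ k x) (ρ k y) = g x y

/-- The volume of an inner product: the square root of its Gram determinant in a fixed basis. -/
def volume (g : LinearMap.BilinForm ℝ V) : ℝ :=
  Real.sqrt (Matrix.det (Matrix.of fun i j =>
    g (Module.finBasis ℝ V i) (Module.finBasis ℝ V j)))

/-- The set `𝓜₁` of the `ρ`-invariant inner products of volume `v`. -/
def metricsOfVolume (ρ : Representation ℝ K V) (v : ℝ) : Set (LinearMap.BilinForm ℝ V) :=
  {g | IsInvariantInner ρ g ∧ volume g = v}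

/-- The exponential `e^A` of an endomorphism. -/
def expEnd (A : V →ₗ[ℝ] V) : V →ₗ[ℝ] V :=
  Matrix.toLin (Module.finBasis ℝ V) (Module.finBasis ℝ V)
    (NormedSpace.exp (LinearMap.toMatrix (Module.finBasis ℝ V) (Module.finBasis ℝ V) A))

/-- The metric `(e^A x, y)` obtained from `g = (·, ·)`. -/
def deform (g : LinearMap.BilinForm ℝ V) (A : V →ₗ[ℝ] V) : LinearMap.BilinForm ℝ V :=
  g ∘ₗ expEnd A

/-- The directions of variation of `g` within the invariant metrics of the same volume:
the `g`-symmetric, `ρ`-equivariant operators with zero trace. -/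
structure IsVariation (ρ : Representation ℝ K V) (g : LinearMap.BilinForm ℝ V)
    (A : V →ₗ[ℝ] V) : Prop where
  symm : ∀ x y, g (A x) y = g x (A y)
  equivariant : ∀ k x, A (ρ k x) = ρ k (A x)
  trace_eq_zero : LinearMap.trace ℝ V A = 0

/-- `g` is a critical point of the functional `S` on the invariant metrics of volume `v`. -/
def IsCriticalPoint (S : LinearMap.BilinForm ℝ V → ℝ) (ρ : Representation ℝ K V) (v : ℝ)
    (g : LinearMap.BilinForm ℝ V) : Prop :=
  g ∈ metricsOfVolume ρ v ∧
    ∀ A, IsVariation ρ g A → HasDerivAt (fun t : ℝ => S (deform g (t • A))) 0 0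

/-- `g` is a degenerate critical point of `S` on the invariant metrics of volume `v`: it is
critical and the second variation
`(A, B) ↦ ∂²/∂s∂t S((e^{tB + sA} ·, ·))` at `t = s = 0` has a nonzero element `A` in its kernel. -/
def IsDegenerateCriticalPoint (S : LinearMap.BilinForm ℝ V → ℝ) (ρ : Representation ℝ K V)
    (v : ℝ) (g : LinearMap.BilinForm ℝ V) : Prop :=
  IsCriticalPoint S ρ v g ∧
    ∃ A, IsVariation ρ g A ∧ A ≠ 0 ∧ ∀ B, IsVariation ρ g B →
      HasDerivAt (fun s : ℝ => deriv (fun t : ℝ => S (deform g (t • B + s • A))) 0) 0 0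

/-- A decomposition of `V` into a sum of pairwise `g`-orthogonal irreducible submodules
`P 0, …, P (q - 1)`, together with a `g`-orthonormal basis `e i 0, …, e i (d i - 1)` of each. -/
structure Decomposition (ρ : Representation ℝ K V) (g : LinearMap.BilinForm ℝ V) where
  q : ℕ
  P : Fin q → Submodule ℝ V
  invariant : ∀ i k x, x ∈ P i → ρ k x ∈ P i
  irreducible : ∀ i (W : Submodule ℝ V), W ≤ P i → (∀ k x, x ∈ W → ρ k x ∈ W) →
    W = ⊥ ∨ W = P i
  orthogonal : ∀ i j, i ≠ j → ∀ x ∈ P i, ∀ y ∈ P j, g x y = 0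
  iSup_eq_top : ⨆ i, P i = ⊤
  d : Fin q → ℕ
  d_pos : ∀ i, 0 < d i
  e : (i : Fin q) → Fin (d i) → V
  span_e : ∀ i, Submodule.span ℝ (Set.range (e i)) = P i
  orthonormal : ∀ i a b, g (e i a) (e i b) = if a = b then 1 else 0

/-- `P i` and `P j` are isomorphic submodules. -/
def Decomposition.Isomorphic {ρ : Representation ℝ K V} {g : LinearMap.BilinForm ℝ V}
    (D : Decomposition ρ g) (i j : Fin D.q) : Prop :=
  ∃ φ : D.P i ≃ₗ[ℝ] D.P j, ∀ k (x : D.P i),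
    (φ ⟨ρ k x, D.invariant i k x x.2⟩ : V) = ρ k (φ x)

end Metrics

section MatrixF

variable {𝔤 : Type*} [LieRing 𝔤] [LieAlgebra ℝ 𝔤] [FiniteDimensional ℝ 𝔤] {𝔭 : Submodule ℝ 𝔤}
  {K : Type*} [Group K] {ρ : Representation ℝ K 𝔭} {g : LinearMap.BilinForm ℝ 𝔭}

/-- The numbers `[k; i j] = ∑_{α, β, γ} ([e_i^α, e_j^β]_𝔭, e_k^γ)²`. -/
def Decomposition.coeff (D : Decomposition ρ g) (π : 𝔤 →ₗ[ℝ] 𝔭) (k i j : Fin D.q) : ℝ :=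
  ∑ α : Fin (D.d i), ∑ β : Fin (D.d j), ∑ γ : Fin (D.d k),
    (g (π ⁅(D.e i α : 𝔤), (D.e j β : 𝔤)⁆) (D.e k γ)) ^ 2

/-- The value `b_i` of the Killing form on a unit vector of `P i` (the first basis vector). -/
def Decomposition.killingValue (D : Decomposition ρ g) (i : Fin D.q) : ℝ :=
  killingForm ℝ 𝔤 (D.e i ⟨0, D.d_pos i⟩ : 𝔤) (D.e i ⟨0, D.d_pos i⟩ : 𝔤)

/-- The `q × q` matrix `F`. -/
def Decomposition.matrixF (D : Decomposition ρ g) (π : 𝔤 →ₗ[ℝ] 𝔭) :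
    Matrix (Fin D.q) (Fin D.q) ℝ :=
  Matrix.of fun i j =>
    if i = j then
      -(D.killingValue i * D.d i / 2)
        - 1 / 4 * ∑ m, ∑ k, (D.coeff π i k m + 2 * D.coeff π k i m)
        - 1 / 2 * ∑ m, (D.coeff π m i i - 2 * D.coeff π i i m)
    else
      1 / 2 * ∑ k, (D.coeff π j i k + D.coeff π i k j - D.coeff π k i j)

end MatrixF

/-! ### Lie groups -/

section LieGroup

instance : ENat.LEInfty (minSmoothness ℝ 3) where
  out := by
    rw [minSmoothness_of_isRCLikeNormedField]
    exact ENat.LEInfty.out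

/-- Finite-dimensional real normed spaces are complete. -/
instance (E : Type*) [NormedAddCommGroup E] [NormedSpace ℝ E] [FiniteDimensional ℝ E] :
    CompleteSpace E :=
  FiniteDimensional.complete ℝ E

variable (E : Type*) [NormedAddCommGroup E] [NormedSpace ℝ E]
  {G : Type*} [TopologicalSpace G] [ChartedSpace E G] [Group G]

instance [FiniteDimensional ℝ E] (x : G) : FiniteDimensional ℝ (TangentSpace 𝓘(ℝ, E) x) :=
  inferInstanceAs (FiniteDimensional ℝ E)

/-- The adjoint operator `Ad(a)`, the differential at the identity of `x ↦ a x a⁻¹`. -/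
def Ad (a : G) : GroupLieAlgebra 𝓘(ℝ, E) G →ₗ[ℝ] GroupLieAlgebra 𝓘(ℝ, E) G :=
  (mfderiv 𝓘(ℝ, E) 𝓘(ℝ, E) (fun x : G => a * x * a⁻¹) 1).toLinearMap

/-- `X` is the velocity at time `0` of a smooth curve in `H` through the identity. -/
def IsVelocity (H : Subgroup G) (X : GroupLieAlgebra 𝓘(ℝ, E) G) : Prop :=
  ∃ γ : ℝ → G, ContMDiff 𝓘(ℝ, ℝ) 𝓘(ℝ, E) ∞ γ ∧ γ 0 = 1 ∧ (∀ t, γ t ∈ H) ∧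
    (mfderiv 𝓘(ℝ, ℝ) 𝓘(ℝ, E) γ 0 (1 : ℝ) : E) = X

theorem Ad_one : Ad E (1 : G) = LinearMap.id := by
  have h4 : (fun x : G => 1 * x * 1⁻¹) = id := by ext x; simp
  apply LinearMap.ext
  intro X
  have h : mfderiv 𝓘(ℝ, E) 𝓘(ℝ, E) (fun x : G => 1 * x * 1⁻¹) (1 : G)
      = mfderiv 𝓘(ℝ, E) 𝓘(ℝ, E) id (1 : G) := by rw [h4]
  exact (DFunLike.congr_fun h X).trans (by rw [mfderiv_id]; rfl)

theorem IsVelocity.zero (H : Subgroup G) : IsVelocity E H 0 := by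
  refine ⟨fun _ => 1, contMDiff_const, rfl, fun _ => H.one_mem, ?_⟩
  rw [mfderiv_const]; rfl

theorem IsVelocity.smul {H : Subgroup G} {X : GroupLieAlgebra 𝓘(ℝ, E) G}
    (hX : IsVelocity E H X) (c : ℝ) : IsVelocity E H (c • X) := by
  obtain ⟨γ, hγ, h0, hH, hX⟩ := hX
  have hc : ContMDiff 𝓘(ℝ, ℝ) 𝓘(ℝ, ℝ) ∞ (fun t : ℝ => c * t) :=
    (contDiff_const.mul contDiff_id).contMDiff
  refine ⟨fun t => γ (c * t), hγ.comp hc, by simp [h0], fun t => hH _, ?_⟩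
  have h1 : ∀ y : ℝ, y = 0 → HasMFDerivAt 𝓘(ℝ, ℝ) 𝓘(ℝ, E) γ y (mfderiv 𝓘(ℝ, ℝ) 𝓘(ℝ, E) γ 0) := by
    intro y hy
    subst hy
    exact (hγ.mdifferentiable (by simp) 0).hasMFDerivAt
  have h2 : HasMFDerivAt 𝓘(ℝ, ℝ) 𝓘(ℝ, ℝ) (fun t : ℝ => c * t) 0
      (c • ContinuousLinearMap.id ℝ ℝ) :=
    ((hasFDerivAt_id (0 : ℝ)).const_mul c).hasMFDerivAt
  have h3 := (HasMFDerivAt.comp (0 : ℝ) (h1 (c * 0) (by simp)) h2).mfderiv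
  have h4 := DFunLike.congr_fun h3 (1 : ℝ)
  refine Eq.trans h4 ?_
  rw [← hX]
  exact (mfderiv 𝓘(ℝ, ℝ) 𝓘(ℝ, E) γ 0).map_smul c (1 : ℝ)

variable [LieGroup 𝓘(ℝ, E) ∞ G]

theorem hasMFDerivAt_conj (a y : G) (hy : y = 1) :
    HasMFDerivAt 𝓘(ℝ, E) 𝓘(ℝ, E) (fun x : G => a * x * a⁻¹) y
      (mfderiv 𝓘(ℝ, E) 𝓘(ℝ, E) (fun x : G => a * x * a⁻¹) 1) := by
  subst hy
  have h : ContMDiff 𝓘(ℝ, E) 𝓘(ℝ, E) ∞ (fun x : G => a * x * a⁻¹) :=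
    (contMDiff_const.mul contMDiff_id).mul contMDiff_const
  exact (h.mdifferentiable (by simp) 1).hasMFDerivAt

theorem Ad_mul (a b : G) : Ad E (a * b) = Ad E a ∘ₗ Ad E b := by
  have h1 := hasMFDerivAt_conj E a (b * 1 * b⁻¹) (by simp)
  have h2 := hasMFDerivAt_conj E b 1 rfl
  have h3 := (HasMFDerivAt.comp (1 : G) h1 h2).mfderiv
  have h4 : (fun x : G => a * x * a⁻¹) ∘ (fun x : G => b * x * b⁻¹)
      = fun x : G => a * b * x * (a * b)⁻¹ := by
    ext x; simp [mul_assoc]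
  rw [h4] at h3
  apply LinearMap.ext
  intro X
  exact DFunLike.congr_fun h3 X

theorem IsVelocity.add {H : Subgroup G} {X Y : GroupLieAlgebra 𝓘(ℝ, E) G}
    (hX : IsVelocity E H X) (hY : IsVelocity E H Y) : IsVelocity E H (X + Y) := by
  obtain ⟨γ, hγ, h0, hH, hX⟩ := hX
  obtain ⟨δ, hδ, k0, kH, hY⟩ := hY
  refine ⟨fun t => γ t * δ t, hγ.mul hδ, by simp [h0, k0],
    fun t => H.mul_mem (hH t) (kH t), ?_⟩
  have h1 := (hγ.mdifferentiable (by simp) 0).hasMFDerivAt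
  have h2 := (hδ.mdifferentiable (by simp) 0).hasMFDerivAt
  have hm : MDifferentiableAt (𝓘(ℝ, E).prod 𝓘(ℝ, E)) 𝓘(ℝ, E)
      (fun p : G × G => p.1 * p.2) (γ 0, δ 0) :=
    (contMDiff_mul 𝓘(ℝ, E) ∞).mdifferentiable (by simp) _
  have h3 := (HasMFDerivAt.comp (0 : ℝ) hm.hasMFDerivAt (h1.prodMk h2)).mfderiv
  have h4 := DFunLike.congr_fun h3 (1 : ℝ)
  refine Eq.trans h4 ?_
  refine Eq.trans (mfderiv_prod_eq_add_apply hm) ?_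
  have e1 : (fun x : G => x * δ 0) = id := by ext x; simp [k0]
  have e2 : (fun x : G => γ 0 * x) = id := by ext x; simp [h0]
  have e3 : mfderiv 𝓘(ℝ, E) 𝓘(ℝ, E) (fun x : G => x * δ 0) (γ 0)
      = mfderiv 𝓘(ℝ, E) 𝓘(ℝ, E) id (γ 0) := by rw [e1]
  have e4 : mfderiv 𝓘(ℝ, E) 𝓘(ℝ, E) (fun x : G => γ 0 * x) (δ 0)
      = mfderiv 𝓘(ℝ, E) 𝓘(ℝ, E) id (δ 0) := by rw [e2]
  rw [mfderiv_id] at e3 e4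
  rw [← hX, ← hY]
  refine congrArg₂ (fun a b : E => a + b) ?_ ?_
  · exact DFunLike.congr_fun e3 _
  · exact DFunLike.congr_fun e4 _

theorem IsVelocity.Ad {H : Subgroup G} {X : GroupLieAlgebra 𝓘(ℝ, E) G}
    (hX : IsVelocity E H X) {a : G} (ha : a ∈ H) : IsVelocity E H (Ad E a X) := by
  obtain ⟨γ, hγ, h0, hH, hX⟩ := hX
  refine ⟨fun t => a * γ t * a⁻¹, (contMDiff_const.mul hγ).mul contMDiff_const, by simp [h0],
    fun t => H.mul_mem (H.mul_mem ha (hH t)) (H.inv_mem ha), ?_⟩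
  have h1 := (hγ.mdifferentiable (by simp) 0).hasMFDerivAt
  have h3 := (HasMFDerivAt.comp (0 : ℝ) (hasMFDerivAt_conj E a (γ 0) h0) h1).mfderiv
  refine Eq.trans (DFunLike.congr_fun h3 (1 : ℝ)) ?_
  rw [← hX]
  rfl

/-- The Lie algebra `𝔥` of a closed subgroup `H`. -/
def subgroupLieAlgebra (H : Subgroup G) : Submodule ℝ (GroupLieAlgebra 𝓘(ℝ, E) G) where
  carrier := {X | IsVelocity E H X}
  zero_mem' := IsVelocity.zero E H
  add_mem' := IsVelocity.add E
  smul_mem' c _ hX := IsVelocity.smul E hX c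

/-- A bi-invariant inner product on the Lie algebra of `G`. -/
structure IsBiInvariantInner (Q : LinearMap.BilinForm ℝ (GroupLieAlgebra 𝓘(ℝ, E) G)) : Prop where
  symm : ∀ x y, Q x y = Q y x
  pos : ∀ x, x ≠ 0 → 0 < Q x x
  inv : ∀ a x y, Q (Ad E a x) (Ad E a y) = Q x y

/-- The `Q`-orthogonal complement `𝔭` of `𝔥`. -/
def complement (H : Subgroup G) (Q : LinearMap.BilinForm ℝ (GroupLieAlgebra 𝓘(ℝ, E) G)) :
    Submodule ℝ (GroupLieAlgebra 𝓘(ℝ, E) G) :=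
  Q.orthogonal (subgroupLieAlgebra E H)

theorem Ad_mem_complement (H : Subgroup G)
    {Q : LinearMap.BilinForm ℝ (GroupLieAlgebra 𝓘(ℝ, E) G)} (hQ : IsBiInvariantInner E Q)
    (a : H) (x : GroupLieAlgebra 𝓘(ℝ, E) G) (hx : x ∈ complement E H Q) :
    Ad E (a : G) x ∈ complement E H Q := by
  intro y hy
  have h1 : Ad E (a : G) (Ad E (a : G)⁻¹ y) = y := by
    rw [← LinearMap.comp_apply, ← Ad_mul, mul_inv_cancel, Ad_one]
    rfl
  have h2 : Q (Ad E (a : G)⁻¹ y) x = 0 :=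
    hx _ (IsVelocity.Ad E hy (H.inv_mem a.2))
  rw [← hQ.inv (a : G), h1] at h2
  exact h2

/-- The isotropy representation of `H` on `𝔭`, by the operators `Ad(a)`, `a ∈ H`. -/
def isotropy (H : Subgroup G) {Q : LinearMap.BilinForm ℝ (GroupLieAlgebra 𝓘(ℝ, E) G)}
    (hQ : IsBiInvariantInner E Q) : Representation ℝ H (complement E H Q) where
  toFun a := (Ad E (a : G)).restrict (Ad_mem_complement E H hQ a)
  map_one' := by
    ext x
    simp [Ad_one]
  map_mul' a b := by
    ext x
    simp [Ad_mul]

/-- `G/H` is almost effective: `𝔥` contains no nonzero ideal of the Lie algebra of `G`. -/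
def IsAlmostEffective [FiniteDimensional ℝ E] (H : Subgroup G) : Prop :=
  ∀ I : LieIdeal ℝ (GroupLieAlgebra 𝓘(ℝ, E) G),
    (I : Submodule ℝ (GroupLieAlgebra 𝓘(ℝ, E) G)) ≤ subgroupLieAlgebra E H → I = ⊥

variable [FiniteDimensional ℝ E]

theorem isCompl_complement (H : Subgroup G)
    {Q : LinearMap.BilinForm ℝ (GroupLieAlgebra 𝓘(ℝ, E) G)} (hQ : IsBiInvariantInner E Q) :
    IsCompl (complement E H Q) (subgroupLieAlgebra E H) := by
  refine ((LinearMap.BilinForm.isCompl_orthogonal_iff_disjoint ?_).2 ?_).symm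
  · intro x y h
    rw [hQ.symm, h]
  · rw [Submodule.disjoint_def]
    intro x hx hx'
    by_contra h
    exact (hQ.pos x h).ne' (hx' x hx)

/-- The projection of the Lie algebra of `G` onto `𝔭` along `𝔥`. -/
def proj (H : Subgroup G) {Q : LinearMap.BilinForm ℝ (GroupLieAlgebra 𝓘(ℝ, E) G)}
    (hQ : IsBiInvariantInner E Q) : GroupLieAlgebra 𝓘(ℝ, E) G →ₗ[ℝ] complement E H Q :=
  Submodule.projectionOnto _ _ (isCompl_complement E H hQ)

/-- The scalar curvature functional `S` on the invariant metrics of `G/H`. -/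
def S (H : Subgroup G) {Q : LinearMap.BilinForm ℝ (GroupLieAlgebra 𝓘(ℝ, E) G)}
    (hQ : IsBiInvariantInner E Q) : LinearMap.BilinForm ℝ (complement E H Q) → ℝ :=
  scalarCurvature (proj E H hQ)

end LieGroup

end HomogeneousMetric

end

noncomputable section

namespace HomogeneousMetric

/-! ### Orthonormal bases of a bilinear form -/

section Orthonormal

variable {V ι : Type*} [AddCommGroup V] [Module ℝ V] [Fintype ι] [DecidableEq ι]

/-! Fix a decomposition and scale the metric by `e^{a i}` on the `i`-th summand. The scalar
curvature becomes an explicit sum of exponentials in `a` (`diagScalar`, reached through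
`scalarCurvature_eq` and `scalarCurvature_deform_diag`), and `F` is its Hessian at `a = 0`
(`diagHess_eq`); in particular `F` is symmetric. Scalar curvature is homogeneous of degree `-1`
under `a ↦ a + s·1`, so `F 1` is minus the gradient at `0` (`diagHess_one`). At a critical point the
gradient vanishes on the trace-free vectors, that is on the orthogonal complement of the vector `d`
of dimensions, hence `F 1 = ν d` for some `ν`.

Degenerate implies singular. A degenerate direction is symmetric and commutes with the isotropy
representation, so it is scalar on the summands of a suitable decomposition (`exists_decomposition`)
and corresponds to a vector `a ≠ 0` with `d · a = 0`. Lying in the kernel of the second variation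
forces `F a = μ d`. Now `1` and `a` are linearly independent, because `d · 1 > 0`, and `F` sends
both into the line spanned by `d`; so `F` has a kernel.

Singular implies degenerate. With pairwise non-isomorphic summands, Schur's lemma makes every
variation diagonal (`exists_eq_diag`). If `F a = 0` with `a ≠ 0`, symmetry of `F` gives `ν (d · a) =
0`. When `ν ≠ 0` the vector `a` is trace-free and is a degenerate direction. It remains to exclude
`ν = 0`, where the scalar curvature is stationary under every diagonal scaling. A maximum argument
over the scales of the metric relative to the bi-invariant inner product
(`central_of_diagGrad_eq_zero`) then makes `𝔭` central. Since `G` is connected, the isotropy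
representation is trivial (`adOrbit_eq_of_central`), its irreducible summands are isomorphic lines,
and so there is at most one. As the dimension is not `1` there is none, and the empty determinant is
`1`, contradicting singularity.

The algebra needs three facts from the group: the differential of `Ad` is the bracket, `Ad`
preserves brackets and hence the Killing form, and `Ad`-invariance differentiates to `ad`-skewness.
They are derived from the second-order expansion of the multiplication in a chart. -/

/-- The basis `b` is orthonormal for the form `g`. -/
def OrthonormalFor (g : LinearMap.BilinForm ℝ V) (b : Module.Basis ι ℝ V) : Prop :=
  ∀ i j, g (b i) (b j) = if i = j then 1 else 0

variable {g : LinearMap.BilinForm ℝ V} {b : Module.Basis ι ℝ V}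

omit [Fintype ι] in
theorem OrthonormalFor.apply_basis (hb : OrthonormalFor g b) (i j : ι) :
    g (b i) (b j) = if i = j then 1 else 0 := hb i j

theorem OrthonormalFor.repr_eq (hb : OrthonormalFor g b) (v : V) (i : ι) :
    b.repr v i = g v (b i) := by
  conv_rhs => rw [← b.sum_repr v]
  simp only [map_sum, map_smul, LinearMap.sum_apply, LinearMap.smul_apply, hb.apply_basis,
    smul_eq_mul, mul_ite, mul_one, mul_zero, Finset.sum_ite_eq', Finset.mem_univ, if_true]

theorem OrthonormalFor.apply_eq_sum (hb : OrthonormalFor g b) (x y : V) :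
    g x y = ∑ i, g x (b i) * g y (b i) := by
  conv_lhs => rw [← b.sum_repr y]
  simp only [map_sum, map_smul, smul_eq_mul, hb.repr_eq]
  exact Finset.sum_congr rfl fun i _ => mul_comm _ _

theorem OrthonormalFor.symm (hb : OrthonormalFor g b) (x y : V) : g x y = g y x := by
  rw [hb.apply_eq_sum, hb.apply_eq_sum y x]
  exact Finset.sum_congr rfl fun i _ => mul_comm _ _

theorem OrthonormalFor.eq_sum (hb : OrthonormalFor g b) (x : V) : x = ∑ i, g x (b i) • b i := by
  conv_lhs => rw [← b.sum_repr x]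
  simp only [hb.repr_eq]

theorem OrthonormalFor.trace_eq (hb : OrthonormalFor g b) (T : V →ₗ[ℝ] V) :
    LinearMap.trace ℝ V T = ∑ i, g (T (b i)) (b i) := by
  rw [LinearMap.trace_eq_matrix_trace ℝ b]
  simp [Matrix.trace, LinearMap.toMatrix_apply, hb.repr_eq]

theorem OrthonormalFor.eq_zero_of_forall (hb : OrthonormalFor g b) (x : V)
    (h : ∀ y, g x y = 0) : x = 0 := by
  rw [hb.eq_sum x]; simp [h]

theorem OrthonormalFor.nondegenerate (hb : OrthonormalFor g b) : g.Nondegenerate :=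
  ⟨fun x hx => hb.eq_zero_of_forall x hx,
    fun x hx => hb.eq_zero_of_forall x fun y => by rw [hb.symm]; exact hx y⟩

theorem OrthonormalFor.sharp_apply [FiniteDimensional ℝ V] (hb : OrthonormalFor g b)
    (φ : Module.Dual ℝ V) (y : V) : g (sharp g φ) y = φ y := by
  rw [sharp, dif_pos hb.nondegenerate]
  exact LinearMap.BilinForm.apply_toDual_symm_apply (hB := hb.nondegenerate) φ y

end Orthonormal

/-! ### The scalar curvature in an orthonormal basis -/

section ScalarCurvature

variable {𝔤 : Type*} [LieRing 𝔤] [LieAlgebra ℝ 𝔤] {𝔭 : Submodule ℝ 𝔤}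

/-- `π` is a projection along a complement `ker π` of `𝔭` with `[ker π, 𝔭] ⊆ 𝔭`, and the Lie
algebra is unimodular. -/
structure IsReductive (π : 𝔤 →ₗ[ℝ] 𝔭) : Prop where
  proj_coe : ∀ y : 𝔭, π y = y
  coe_lie : ∀ h, π h = 0 → ∀ y : 𝔭, (π ⁅h, (y : 𝔤)⁆ : 𝔤) = ⁅h, (y : 𝔤)⁆
  trace_ad : ∀ x : 𝔤, LinearMap.trace ℝ 𝔤 (LieAlgebra.ad ℝ 𝔤 x) = 0

/-- `g` is infinitesimally invariant under `ker π`. -/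
def IsKerSkew (π : 𝔤 →ₗ[ℝ] 𝔭) (g : LinearMap.BilinForm ℝ 𝔭) : Prop :=
  ∀ h, π h = 0 → ∀ x y : 𝔭, g (π ⁅h, (x : 𝔤)⁆) y + g x (π ⁅h, (y : 𝔤)⁆) = 0

@[simp] theorem bracketP_apply (π : 𝔤 →ₗ[ℝ] 𝔭) (X : 𝔤) (Y : 𝔭) :
    bracketP π X Y = π ⁅X, (Y : 𝔤)⁆ := rfl

/-- The projection onto `ker π`. -/
def kerPart (π : 𝔤 →ₗ[ℝ] 𝔭) : 𝔤 →ₗ[ℝ] 𝔤 := LinearMap.id - 𝔭.subtype ∘ₗ π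

theorem kerPart_apply (π : 𝔤 →ₗ[ℝ] 𝔭) (x : 𝔤) : kerPart π x = x - (π x : 𝔤) := rfl

variable {π : 𝔤 →ₗ[ℝ] 𝔭}

theorem IsReductive.proj_kerPart (hπ : IsReductive π) (x : 𝔤) : π (kerPart π x) = 0 := by
  rw [kerPart_apply, map_sub, hπ.proj_coe, sub_self]

theorem IsReductive.kerPart_of_mem (hπ : IsReductive π) (x : 𝔤) (hx : x ∈ 𝔭) :
    kerPart π x = 0 := by
  have := hπ.proj_coe ⟨x, hx⟩
  rw [kerPart_apply]
  simp only at this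
  rw [this]; simp

theorem IsReductive.kerPart_kerPart (hπ : IsReductive π) (x : 𝔤) :
    kerPart π (kerPart π x) = kerPart π x := by
  rw [kerPart_apply π (kerPart π x), hπ.proj_kerPart]; simp

theorem IsReductive.lie_kerPart (hπ : IsReductive π) (z : 𝔭) (x : 𝔤) :
    (π ⁅(z : 𝔤), kerPart π x⁆ : 𝔤) = ⁅(z : 𝔤), kerPart π x⁆ := by
  have := hπ.coe_lie _ (hπ.proj_kerPart x) z
  rw [← lie_skew, map_neg, Submodule.coe_neg, this]

variable [FiniteDimensional ℝ 𝔤]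

/-- Split the identity as `π` plus `kerPart π` before applying `T`; cyclicity of the trace turns the
first piece into a trace on `𝔭`. -/
theorem trace_eq_trace_add_trace (π : 𝔤 →ₗ[ℝ] 𝔭) (T : 𝔤 →ₗ[ℝ] 𝔤) :
    LinearMap.trace ℝ 𝔤 T = LinearMap.trace ℝ 𝔭 (π ∘ₗ T ∘ₗ 𝔭.subtype)
      + LinearMap.trace ℝ 𝔤 (T ∘ₗ kerPart π) := by
  have h : T = (T ∘ₗ 𝔭.subtype) ∘ₗ π + T ∘ₗ kerPart π := by
    ext x
    simp [kerPart_apply]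
  conv_lhs => rw [h]
  rw [map_add, LinearMap.trace_comp_comm' π]

/-- For `z ∈ 𝔭` the operator `ad z` maps `ker π` into `𝔭`, so it has no diagonal block on `ker π`;
unimodularity then kills the trace of the block on `𝔭`. -/
theorem IsReductive.trace_bracketP (hπ : IsReductive π) (z : 𝔭) :
    LinearMap.trace ℝ 𝔭 (bracketP π z) = 0 := by
  have h := trace_eq_trace_add_trace π (LieAlgebra.ad ℝ 𝔤 (z : 𝔤))
  have h2 : LieAlgebra.ad ℝ 𝔤 (z : 𝔤) ∘ₗ kerPart π
      = (LieAlgebra.ad ℝ 𝔤 (z : 𝔤) ∘ₗ kerPart π) ∘ₗ kerPart π := by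
    ext x
    simp [hπ.kerPart_kerPart]
  have h3 : kerPart π ∘ₗ (LieAlgebra.ad ℝ 𝔤 (z : 𝔤) ∘ₗ kerPart π) = 0 := by
    ext x
    simp only [LinearMap.comp_apply, LieAlgebra.ad_apply, LinearMap.zero_apply]
    apply hπ.kerPart_of_mem
    rw [← hπ.lie_kerPart]
    exact Subtype.coe_prop _
  rw [hπ.trace_ad, h2, LinearMap.trace_comp_comm' (kerPart π), h3, map_zero, add_zero] at h
  exact h.symm

/-- The paths `𝔭 → ker π → 𝔭` and `ker π → 𝔭 → ker π` contribute equal traces by cyclicity, whence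
the factor `2`; there is no path `ker π → ker π → ker π` because `ad x` maps `ker π` into `𝔭`. -/
theorem IsReductive.killingForm_eq (hπ : IsReductive π) (x : 𝔭) :
    killingForm ℝ 𝔤 (x : 𝔤) (x : 𝔤)
      = LinearMap.trace ℝ 𝔭 (bracketP π x ∘ₗ bracketP π x)
        + 2 * LinearMap.trace ℝ 𝔭
          (π ∘ₗ LieAlgebra.ad ℝ 𝔤 x ∘ₗ kerPart π ∘ₗ LieAlgebra.ad ℝ 𝔤 x ∘ₗ 𝔭.subtype) := by
  set a := LieAlgebra.ad ℝ 𝔤 (x : 𝔤) with ha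
  have h1 : killingForm ℝ 𝔤 (x : 𝔤) (x : 𝔤) = LinearMap.trace ℝ 𝔤 (a ∘ₗ a) := by
    rw [killingForm_apply_apply]
  have h2 : (a ∘ₗ a) ∘ₗ kerPart π = (a ∘ₗ 𝔭.subtype) ∘ₗ (π ∘ₗ a ∘ₗ kerPart π) := by
    ext y
    simp [ha, hπ.lie_kerPart]
  have h3 : π ∘ₗ (a ∘ₗ a) ∘ₗ 𝔭.subtype = bracketP π x ∘ₗ bracketP π x
      + π ∘ₗ a ∘ₗ kerPart π ∘ₗ a ∘ₗ 𝔭.subtype := by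
    ext y
    simp [ha, kerPart_apply]
  rw [h1, trace_eq_trace_add_trace π, h2, LinearMap.trace_comp_comm' (π ∘ₗ a ∘ₗ kerPart π), h3,
    map_add]
  have h4 : (π ∘ₗ a ∘ₗ kerPart π) ∘ₗ (a ∘ₗ 𝔭.subtype)
      = π ∘ₗ a ∘ₗ kerPart π ∘ₗ a ∘ₗ 𝔭.subtype := rfl
  rw [h4]; ring

variable {ι : Type*} [Fintype ι] [DecidableEq ι] {g : LinearMap.BilinForm ℝ 𝔭}
  {b : Module.Basis ι ℝ 𝔭}

/-- The structure constants `g([b i, b j]_𝔭, b k)`. -/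
def structureConstant (π : 𝔤 →ₗ[ℝ] 𝔭) (g : LinearMap.BilinForm ℝ 𝔭) (b : ι → 𝔭)
    (i j k : ι) : ℝ :=
  g (π ⁅(b i : 𝔤), (b j : 𝔤)⁆) (b k)

omit [FiniteDimensional ℝ 𝔤] [Fintype ι] [DecidableEq ι] in
theorem structureConstant_swap (π : 𝔤 →ₗ[ℝ] 𝔭) (g : LinearMap.BilinForm ℝ 𝔭) (b : ι → 𝔭)
    (i j k : ι) : structureConstant π g b j i k = - structureConstant π g b i j k := by
  unfold structureConstant
  rw [← lie_skew, map_neg, map_neg, LinearMap.neg_apply]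

theorem leviCivita_apply_apply (hb : OrthonormalFor g b) (x y z : 𝔭) :
    g (leviCivita π g x y) z
      = (g (π ⁅(x : 𝔤), (y : 𝔤)⁆) z + g (π ⁅(z : 𝔤), (x : 𝔤)⁆) y
        + g x (π ⁅(z : 𝔤), (y : 𝔤)⁆)) / 2 :=
  hb.sharp_apply (koszul π g x y) z

theorem leviCivita_basis (hb : OrthonormalFor g b) (i j k : ι) :
    g (leviCivita π g (b i) (b j)) (b k)
      = (structureConstant π g b i j k + structureConstant π g b k i j
        + structureConstant π g b k j i) / 2 := by
  rw [leviCivita_apply_apply hb, hb.symm (b i)]; rfl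

theorem scalarCurvature_eq_sum_curvature (hb : OrthonormalFor g b) :
    scalarCurvature π g = ∑ i, ∑ j, g (curvature π g (b i) (b j) (b j)) (b i) := by
  rw [scalarCurvature, hb.trace_eq, Finset.sum_comm]
  refine Finset.sum_congr rfl fun j _ => ?_
  rw [LinearMap.comp_apply, hb.sharp_apply]
  exact hb.trace_eq _

omit [DecidableEq ι] in
theorem sum_cyclic (f : ι → ι → ι → ℝ) :
    ∑ i, ∑ j, ∑ k, f j k i = ∑ i, ∑ j, ∑ k, f i j k := by
  rw [Finset.sum_comm]
  exact Finset.sum_congr rfl fun j _ => Finset.sum_comm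

/-- The scalar curvature of a unimodular homogeneous space. -/
theorem scalarCurvature_eq (hπ : IsReductive π) (hg : IsKerSkew π g) (hb : OrthonormalFor g b) :
    scalarCurvature π g = -(1 / 2) * ∑ i, killingForm ℝ 𝔤 (b i : 𝔤) (b i : 𝔤)
      - 1 / 4 * ∑ i, ∑ j, ∑ k, structureConstant π g b i j k ^ 2 := by
  set c := structureConstant π g b with hc
  have hsw : ∀ i j k, c j i k = - c i j k := structureConstant_swap π g b
  -- `N` collects the terms passing through the isotropy algebra. They occur in the Killing form
  -- with factor `2` and in the curvature with factor `-1`, so they are absorbed exactly by the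
  -- coefficient `-1/2`.
  set N : ι → ι → ℝ := fun i j => g (π ⁅(b i : 𝔤), kerPart π ⁅(b i : 𝔤), (b j : 𝔤)⁆⁆) (b j)
    with hN
  have hself : ∀ i k, c i i k = 0 := fun i k => by have := hsw i i k; linarith
  have htr : ∀ k, ∑ i, c k i i = 0 := fun k => by
    have := hπ.trace_bracketP (b k)
    rwa [hb.trace_eq] at this
  have hkill : ∀ i, killingForm ℝ 𝔤 (b i : 𝔤) (b i : 𝔤)
      = ∑ j, ∑ k, c i j k * c i k j + 2 * ∑ j, N i j := fun i => by
    rw [hπ.killingForm_eq, hb.trace_eq, hb.trace_eq]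
    congr 1
    refine Finset.sum_congr rfl fun j _ => ?_
    rw [LinearMap.comp_apply]
    conv_lhs => rw [hb.eq_sum (bracketP π (b i) (b j))]
    simp only [map_sum, map_smul, LinearMap.sum_apply, LinearMap.smul_apply, smul_eq_mul]
    rfl
  have hΓ : ∀ x y z, g (leviCivita π g (b x) (b y)) (b z) = (c x y z + c z x y + c z y x) / 2 :=
    leviCivita_basis hb
  have hcomp : ∀ x y w z, g (leviCivita π g (b x) (leviCivita π g (b y) (b w))) (b z)
      = ∑ k, (c y w k + c k y w + c k w y) / 2 * ((c x k z + c z x k + c z k x) / 2) := by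
    intro x y w z
    conv_lhs => rw [hb.eq_sum (leviCivita π g (b y) (b w))]
    simp only [map_sum, map_smul, LinearMap.sum_apply, LinearMap.smul_apply, smul_eq_mul, hΓ]
  have hR : ∀ x y, g (curvature π g (b x) (b y) (b y)) (b x)
      = ∑ k, (c k y y) * (c x k x)
        + ∑ k, (- ((c x y k + c k x y + c k y x) / 2 * ((c y k x + c x y k + c x k y) / 2))
          - c x y k * ((c k y x + c x k y + c x y k) / 2)) - N x y := by
    intro x y
    have h1 : curvature π g (b x) (b y) (b y)
        = leviCivita π g (b x) (leviCivita π g (b y) (b y))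
          - leviCivita π g (b y) (leviCivita π g (b x) (b y))
          - leviCivita π g (bracketP π (b x) (b y)) (b y)
          - π ⁅kerPart π ⁅(b x : 𝔤), (b y : 𝔤)⁆, (b y : 𝔤)⁆ := rfl
    have h2 : g (leviCivita π g (bracketP π (b x) (b y)) (b y)) (b x)
        = ∑ k, c x y k * ((c k y x + c x k y + c x y k) / 2) := by
      conv_lhs => rw [hb.eq_sum (bracketP π (b x) (b y))]
      simp only [map_sum, map_smul, LinearMap.sum_apply, LinearMap.smul_apply, smul_eq_mul, hΓ]
      rfl
    -- The only use of infinitesimal invariance of `g`: the isotropy term is moved to the other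
    -- argument.
    have h3 : g (π ⁅kerPart π ⁅(b x : 𝔤), (b y : 𝔤)⁆, (b y : 𝔤)⁆) (b x) = N x y := by
      have h4 := hg _ (hπ.proj_kerPart ⁅(b x : 𝔤), (b y : 𝔤)⁆) (b y) (b x)
      have h5 : N x y = - g (π ⁅kerPart π ⁅(b x : 𝔤), (b y : 𝔤)⁆, (b x : 𝔤)⁆) (b y) := by
        rw [hN]
        simp only
        rw [← lie_skew, map_neg, map_neg, LinearMap.neg_apply]
      rw [h5, hb.symm _ (b y)]
      linarith
    rw [h1]
    simp only [map_sub, LinearMap.sub_apply]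
    rw [hcomp, hcomp, h2, h3, Finset.sum_sub_distrib, Finset.sum_neg_distrib]
    have h6 : ∀ k, (c y y k + c k y y + c k y y) / 2 * ((c x k x + c x x k + c x k x) / 2)
        = c k y y * c x k x := fun k => by rw [hself, hself]; ring
    simp only [h6]
    ring
  -- Unimodularity: summing over `y` gives the trace of `ad (b k)` on `𝔭`.
  have hzero : ∑ x, ∑ y, ∑ k, (c k y y) * (c x k x) = 0 := by
    refine Finset.sum_eq_zero fun x _ => ?_
    rw [Finset.sum_comm]
    refine Finset.sum_eq_zero fun k _ => ?_
    rw [← Finset.sum_mul, htr, zero_mul]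
  rw [scalarCurvature_eq_sum_curvature hb]
  simp only [hR, hkill, Finset.sum_add_distrib, Finset.sum_sub_distrib, hzero, zero_add,
    ← Finset.mul_sum]
  have key : ∑ x, ∑ y, ∑ k, (- ((c x y k + c k x y + c k y x) / 2 *
      ((c y k x + c x y k + c x k y) / 2)) - c x y k * ((c k y x + c x k y + c x y k) / 2))
      = ∑ x, ∑ y, ∑ k, (-(1 / 2) * (c x y k * c x k y) - 1 / 4 * c x y k ^ 2) := by
    -- The second bracket sums to zero: after cyclic relabelling the squares have total weight `-1/2
    -- + 1/4 + 1/4` and the cross terms `1/2 - 1/2`.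
    have e : ∀ x y k, (- ((c x y k + c k x y + c k y x) / 2 *
        ((c y k x + c x y k + c x k y) / 2)) - c x y k * ((c k y x + c x k y + c x y k) / 2))
        = (-(1 / 2) * (c x y k * c x k y) - 1 / 4 * c x y k ^ 2)
          + (-(1 / 2) * c x y k ^ 2 + 1 / 4 * c y k x ^ 2 + 1 / 4 * c k x y ^ 2
            + 1 / 2 * (c x y k * c y k x) - 1 / 2 * (c y k x * c k x y)) := by
      intro x y k
      rw [hsw y k x, hsw k x y]
      ring
    have e1 := sum_cyclic fun x y k => c x y k ^ 2
    have e2 := sum_cyclic fun x y k => c y k x ^ 2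
    have e3 := sum_cyclic fun x y k => c x y k * c y k x
    simp only [e, Finset.sum_add_distrib, Finset.sum_sub_distrib, ← Finset.mul_sum]
    linarith
  simp only [Finset.sum_sub_distrib, ← Finset.mul_sum] at key
  linarith

end ScalarCurvature

/-! ### Symmetric operators and irreducible submodules -/

section Schur

variable {V : Type*} [AddCommGroup V] [Module ℝ V]

theorem exists_orthonormalFor [FiniteDimensional ℝ V] {g : LinearMap.BilinForm ℝ V}
    (hs : ∀ x y, g x y = g y x) (hp : ∀ x, x ≠ 0 → 0 < g x x) :
    ∃ b : Module.Basis (Fin (Module.finrank ℝ V)) ℝ V, OrthonormalFor g b := by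
  obtain ⟨b, hb⟩ := LinearMap.BilinForm.exists_orthogonal_basis (B := g) ⟨hs⟩
  have hpos : ∀ i, 0 < g (b i) (b i) := fun i => hp _ (b.ne_zero i)
  have hu : ∀ i, IsUnit (Real.sqrt (g (b i) (b i)))⁻¹ := fun i =>
    (isUnit_iff_ne_zero.2 (inv_ne_zero (Real.sqrt_pos.2 (hpos i)).ne'))
  refine ⟨b.isUnitSMul hu, fun i j => ?_⟩
  simp only [Module.Basis.isUnitSMul_apply, map_smul, LinearMap.smul_apply, smul_eq_mul]
  split_ifs with h
  · subst h
    have h1 := Real.mul_self_sqrt (hpos i).le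
    have h2 := (Real.sqrt_pos.2 (hpos i)).ne'
    field_simp
    nlinarith
  · have : g (b i) (b j) = 0 := hb h
    simp [this]

/-- The Gram matrix of `β` in a `g`-orthonormal basis is real symmetric, so the spectral theorem
applies. -/
theorem exists_eigenvector [FiniteDimensional ℝ V] [Nontrivial V] {g β : LinearMap.BilinForm ℝ V}
    (hs : ∀ x y, g x y = g y x) (hp : ∀ x, x ≠ 0 → 0 < g x x) (hβ : ∀ x y, β x y = β y x) :
    ∃ c : ℝ, ∃ x, x ≠ 0 ∧ ∀ y, β x y = c * g x y := by
  obtain ⟨b, hb⟩ := exists_orthonormalFor hs hp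
  have hM : (Matrix.of fun i j => β (b i) (b j)).IsHermitian := by
    ext i j
    simp [hβ (b j)]
  have : Nonempty (Fin (Module.finrank ℝ V)) := ⟨⟨0, Module.finrank_pos⟩⟩
  let i₀ := Classical.arbitrary (Fin (Module.finrank ℝ V))
  have h1 := hM.mulVec_eigenvectorBasis i₀
  set v := hM.eigenvectorBasis i₀ with hv
  have hv0 : v ≠ 0 := (hM.eigenvectorBasis.orthonormal.ne_zero i₀)
  refine ⟨hM.eigenvalues i₀, ∑ i, v i • b i, ?_, fun y => ?_⟩
  · intro h
    apply hv0
    ext i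
    exact Fintype.linearIndependent_iff.1 b.linearIndependent (fun i => v i) h i
  · have h2 : ∀ j, β (∑ i, v i • b i) (b j) = hM.eigenvalues i₀ * g (∑ i, v i • b i) (b j) := by
      intro j
      have h3 := congrFun h1 j
      simp only [Matrix.mulVec, dotProduct, Matrix.of_apply, Pi.smul_apply, smul_eq_mul] at h3
      simp only [map_sum, map_smul, LinearMap.sum_apply, LinearMap.smul_apply, smul_eq_mul,
        hb.apply_basis, mul_ite, mul_one, mul_zero, Finset.sum_ite_eq', Finset.mem_univ, if_true]
      rw [← h3]
      exact Finset.sum_congr rfl fun i _ => by rw [hβ, mul_comm]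
    rw [hb.apply_eq_sum _ y, Finset.mul_sum]
    conv_lhs => rw [hb.eq_sum y]
    rw [map_sum]
    refine Finset.sum_congr rfl fun j _ => ?_
    rw [map_smul, h2, smul_eq_mul]
    ring

theorem exists_eigenvector_mem [FiniteDimensional ℝ V] {g β : LinearMap.BilinForm ℝ V}
    (hs : ∀ x y, g x y = g y x) (hp : ∀ x, x ≠ 0 → 0 < g x x) (hβ : ∀ x y, β x y = β y x)
    {W : Submodule ℝ V} (hW : W ≠ ⊥) :
    ∃ c : ℝ, ∃ x ∈ W, x ≠ 0 ∧ ∀ y ∈ W, β x y = c * g x y := by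
  have : Nontrivial W := Submodule.nontrivial_iff_ne_bot.2 hW
  obtain ⟨c, x, hx, h⟩ := exists_eigenvector (g := g.restrict W) (β := β.restrict W)
    (fun x y => hs x y) (fun x hx => hp x (by simpa using hx)) (fun x y => hβ x y)
  exact ⟨c, x, x.2, by simpa using hx, fun y hy => h ⟨y, hy⟩⟩

variable {K : Type*} [Group K] {ρ : Representation ℝ K V}

theorem form_rep_left {β : LinearMap.BilinForm ℝ V} (hβ : ∀ k x y, β (ρ k x) (ρ k y) = β x y)
    (k : K) (x y : V) : β (ρ k x) y = β x (ρ k⁻¹ y) := by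
  rw [← hβ k x, ← Module.End.mul_apply, ← map_mul]
  simp

/-- Schur's lemma for symmetric forms: an invariant symmetric form is a multiple of an invariant
inner product on an irreducible submodule. -/
theorem exists_eq_mul_of_irreducible [FiniteDimensional ℝ V] {g β : LinearMap.BilinForm ℝ V}
    (hg : IsInvariantInner ρ g) (hβ : ∀ x y, β x y = β y x)
    (hinv : ∀ k x y, β (ρ k x) (ρ k y) = β x y) {W : Submodule ℝ V}
    (hW : ∀ k x, x ∈ W → ρ k x ∈ W)
    (hirr : ∀ W' ≤ W, (∀ k x, x ∈ W' → ρ k x ∈ W') → W' = ⊥ ∨ W' = W) :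
    ∃ c : ℝ, ∀ x ∈ W, ∀ y ∈ W, β x y = c * g x y := by
  by_cases h0 : W = ⊥
  · refine ⟨0, fun x hx y _ => ?_⟩
    rw [h0, Submodule.mem_bot] at hx
    simp [hx]
  obtain ⟨c, x₀, hx₀, hne, h⟩ := exists_eigenvector_mem hg.symm hg.pos hβ h0
  -- The eigenspace of `β` relative to `g` inside `W`. It is invariant and contains `x₀ ≠ 0`, so
  -- irreducibility makes it all of `W`.
  let W' : Submodule ℝ V :=
    { carrier := {x | x ∈ W ∧ ∀ y ∈ W, β x y = c * g x y}
      zero_mem' := ⟨W.zero_mem, by simp⟩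
      add_mem' := fun {x y} hx hy => ⟨W.add_mem hx.1 hy.1, fun z hz => by
        simp [hx.2 z hz, hy.2 z hz, mul_add]⟩
      smul_mem' := fun t x hx => ⟨W.smul_mem t hx.1, fun z hz => by
        simp only [map_smul, LinearMap.smul_apply, smul_eq_mul, hx.2 z hz]; ring⟩ }
  rcases hirr W' (fun x hx => hx.1) (fun k x hx => ⟨hW k x hx.1, fun y hy => by
    rw [form_rep_left hinv, form_rep_left hg.inv, hx.2 _ (hW _ _ hy)]⟩) with h1 | h1
  · have : x₀ ∈ W' := ⟨hx₀, h⟩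
    rw [h1, Submodule.mem_bot] at this
    exact absurd this hne
  · exact ⟨c, fun x hx y hy => (h1.ge hx).2 y hy⟩

/-- Between non-isomorphic irreducible submodules, every invariant form vanishes. -/
theorem Decomposition.eq_zero_of_not_isomorphic {g β : LinearMap.BilinForm ℝ V}
    [FiniteDimensional ℝ V] (hg : IsInvariantInner ρ g)
    (hβ : ∀ k x y, β (ρ k x) (ρ k y) = β x y) (D : Decomposition ρ g) {i j : Fin D.q}
    (hij : ¬ D.Isomorphic i j) : ∀ x ∈ D.P i, ∀ y ∈ D.P j, β x y = 0 := by
  have he : ∀ γ, D.e j γ ∈ D.P j := fun γ => by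
    rw [← D.span_e]; exact Submodule.subset_span ⟨γ, rfl⟩
  -- `T` represents `β(x, ·)` on `P j` through `g`. It is equivariant, so on `P i` it is zero or an
  -- isomorphism onto `P j`.
  let T : V →ₗ[ℝ] V := ∑ γ, (β.flip (D.e j γ)).smulRight (D.e j γ)
  have hT : ∀ x, T x = ∑ γ, β x (D.e j γ) • D.e j γ := fun x => by simp [T]
  have hTmem : ∀ x, T x ∈ D.P j := fun x => by
    rw [hT]; exact Submodule.sum_mem _ fun γ _ => Submodule.smul_mem _ _ (he γ)
  have hTg : ∀ x, ∀ y ∈ D.P j, g (T x) y = β x y := by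
    intro x y hy
    rw [← D.span_e] at hy
    induction hy using Submodule.span_induction with
    | mem y hy =>
      obtain ⟨γ, rfl⟩ := hy
      rw [hT]
      simp [D.orthonormal]
    | zero => simp
    | add y z _ _ h1 h2 => simp [h1, h2]
    | smul c y _ h => simp [h]
  have hext : ∀ u ∈ D.P j, ∀ w ∈ D.P j, (∀ y ∈ D.P j, g u y = g w y) → u = w := by
    intro u hu w hw h
    by_contra hne
    have h1 := hg.pos (u - w) (sub_ne_zero.2 hne)
    have h2 := h (u - w) (Submodule.sub_mem _ hu hw)
    simp only [map_sub, LinearMap.sub_apply] at h1 h2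
    linarith
  have hequi : ∀ k x, T (ρ k x) = ρ k (T x) := by
    intro k x
    refine hext _ (hTmem _) _ (D.invariant j k _ (hTmem x)) fun y hy => ?_
    rw [hTg _ _ hy, form_rep_left hβ, form_rep_left hg.inv, hTg _ _ (D.invariant j _ _ hy)]
  rcases D.irreducible i (D.P i ⊓ LinearMap.ker T) inf_le_left (fun k x hx =>
    ⟨D.invariant i k x hx.1, by
      have : T x = 0 := hx.2
      simp [hequi, this]⟩) with hk | hk
  · rcases D.irreducible j ((D.P i).map T) (by
      rintro _ ⟨x, _, rfl⟩
      exact hTmem x) (by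
      rintro k _ ⟨x, hx, rfl⟩
      exact ⟨ρ k x, D.invariant i k x hx, hequi k x⟩) with hr | hr
    · intro x hx y hy
      have : T x = 0 := by
        rw [← Submodule.mem_bot ℝ, ← hr]; exact ⟨x, hx, rfl⟩
      rw [← hTg x y hy, this]; simp
    · refine absurd ⟨LinearEquiv.ofBijective
        (T.restrict (p := D.P i) (q := D.P j) fun x _ => hTmem x) ⟨?_, ?_⟩, fun k x => ?_⟩ hij
      · rw [← LinearMap.ker_eq_bot, LinearMap.ker_eq_bot']
        intro x hx
        have h1 : (x : V) ∈ D.P i ⊓ LinearMap.ker T := ⟨x.2, congrArg Subtype.val hx⟩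
        rw [hk, Submodule.mem_bot] at h1
        exact Subtype.ext h1
      · rintro ⟨y, hy⟩
        rw [← hr] at hy
        obtain ⟨x, hx, rfl⟩ := hy
        exact ⟨⟨x, hx⟩, rfl⟩
      · exact hequi k x
  · intro x hx y hy
    have : T x = 0 := (hk.ge hx).2
    rw [← hTg x y hy, this]; simp

/-- A space with a commuting symmetric operator splits orthogonally into irreducible submodules on
which the operator is scalar. -/
theorem exists_irreducible_eigenspaces [FiniteDimensional ℝ V] {g : LinearMap.BilinForm ℝ V}
    (hg : IsInvariantInner ρ g) {U : V →ₗ[ℝ] V} (hU : ∀ x y, g (U x) y = g x (U y))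
    (heq : ∀ k x, U (ρ k x) = ρ k (U x)) (n : ℕ) :
    ∀ W : Submodule ℝ V, Module.finrank ℝ W = n → (∀ k x, x ∈ W → ρ k x ∈ W) →
      (∀ x ∈ W, U x ∈ W) →
      ∃ s : Finset (Submodule ℝ V), s.sup id = W ∧
        (∀ P ∈ s, P ≠ ⊥ ∧ (∀ k x, x ∈ P → ρ k x ∈ P) ∧
          (∀ W' ≤ P, (∀ k x, x ∈ W' → ρ k x ∈ W') → W' = ⊥ ∨ W' = P) ∧
          ∃ c : ℝ, ∀ x ∈ P, U x = c • x) ∧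
        ∀ P ∈ s, ∀ P' ∈ s, P ≠ P' → ∀ x ∈ P, ∀ y ∈ P', g x y = 0 := by
  classical
  induction n using Nat.strong_induction_on with
  | _ n ih =>
  intro W hn hW hUW
  by_cases h0 : W = ⊥
  · exact ⟨∅, by simp [h0], by simp, by simp⟩
  -- `P` is minimal among nonzero subspaces stable under both `ρ` and `U`. An eigenspace of `U` in
  -- `P` is again stable under both, so `U` is scalar on `P`. Then every subspace of `P` is
  -- `U`-stable, and minimality becomes irreducibility under `ρ` alone.
  obtain ⟨P, ⟨hPW, hP0, hPρ, hPU⟩, hmin⟩ := wellFounded_lt.has_min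
    {P : Submodule ℝ V | P ≤ W ∧ P ≠ ⊥ ∧ (∀ k x, x ∈ P → ρ k x ∈ P) ∧ ∀ x ∈ P, U x ∈ P}
    ⟨W, le_rfl, h0, hW, hUW⟩
  have hmin' : ∀ X ≤ P, (∀ k x, x ∈ X → ρ k x ∈ X) → (∀ x ∈ X, U x ∈ X) → X = ⊥ ∨ X = P := by
    intro X hX h1 h2
    by_contra! h
    exact hmin X ⟨hX.trans hPW, h.1, h1, h2⟩ (lt_of_le_of_ne hX h.2)
  obtain ⟨c, hc⟩ : ∃ c : ℝ, ∀ x ∈ P, U x = c • x := by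
    obtain ⟨c, x₀, hx₀, hne, h⟩ := exists_eigenvector_mem (β := g ∘ₗ U) hg.symm hg.pos
      (fun x y => by rw [LinearMap.comp_apply, LinearMap.comp_apply, hU, hg.symm]) hP0
    have hx₀' : U x₀ = c • x₀ := by
      by_contra hne'
      have h1 := hg.pos (U x₀ - c • x₀) (sub_ne_zero.2 hne')
      have h2 := h (U x₀ - c • x₀) (Submodule.sub_mem _ (hPU _ hx₀) (Submodule.smul_mem _ _ hx₀))
      rw [LinearMap.comp_apply] at h2
      simp only [map_sub g, LinearMap.sub_apply, map_smul g, LinearMap.smul_apply, smul_eq_mul]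
        at h1
      linarith
    refine ⟨c, fun x hx => ?_⟩
    rcases hmin' (P ⊓ LinearMap.ker (U - c • LinearMap.id)) inf_le_left (fun k x hx =>
        ⟨hPρ k x hx.1, by
          have : U x - c • x = 0 := hx.2
          have h1 : U (ρ k x) - c • ρ k x = ρ k (U x - c • x) := by rw [heq]; simp
          show U (ρ k x) - c • ρ k x = 0
          rw [h1, this, map_zero]⟩) (fun x hx =>
        ⟨hPU x hx.1, by
          have : U x - c • x = 0 := hx.2
          have h1 : U (U x) - c • U x = U (U x - c • x) := by simp
          show U (U x) - c • U x = 0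
          rw [h1, this, map_zero]⟩) with h1 | h1
    · have h2 : x₀ ∈ P ⊓ LinearMap.ker (U - c • LinearMap.id) := ⟨hx₀, by simp [hx₀']⟩
      rw [h1, Submodule.mem_bot] at h2
      exact absurd h2 hne
    · have h2 : U x - c • x = 0 := (h1.ge hx).2
      exact sub_eq_zero.1 h2
  have hcompl : IsCompl P (g.orthogonal P) := by
    refine (LinearMap.BilinForm.isCompl_orthogonal_iff_disjoint ?_).2 ?_
    · intro x y h
      rw [hg.symm, h]
    · rw [Submodule.disjoint_def]
      intro x hx hx'
      by_contra h
      exact (hg.pos x h).ne' (hx' x hx)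
  -- Modular law: `P` splits off orthogonally inside `W`, and the induction continues on the
  -- complement.
  have hsup : P ⊔ g.orthogonal P ⊓ W = W := by
    rw [← sup_inf_assoc_of_le _ hPW, hcompl.sup_eq_top, top_inf_eq]
  have hlt : g.orthogonal P ⊓ W < W := by
    refine lt_of_le_of_ne inf_le_right fun h => hP0 ?_
    have h1 : P ≤ g.orthogonal P := hPW.trans (h ▸ inf_le_left)
    exact disjoint_self.1 (hcompl.disjoint.mono_right h1)
  obtain ⟨s, hs, hsP, hso⟩ := ih _ (hn ▸ Submodule.finrank_lt_finrank_of_lt hlt)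
    (g.orthogonal P ⊓ W) rfl (fun k x hx => ⟨fun y hy => by
      show g y (ρ k x) = 0
      rw [hg.symm, form_rep_left hg.inv, hg.symm]
      exact hx.1 _ (hPρ _ _ hy), hW k x hx.2⟩) (fun x hx => ⟨fun y hy => by
      show g y (U x) = 0
      rw [← hU]
      exact hx.1 _ (hPU _ hy), hUW x hx.2⟩)
  have hsle : ∀ X ∈ s, X ≤ g.orthogonal P := fun X hX =>
    (Finset.le_sup (f := id) hX).trans (hs.le.trans inf_le_left)
  refine ⟨insert P s, by rw [Finset.sup_insert, hs]; exact hsup, ?_, ?_⟩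
  · intro X hX
    rcases Finset.mem_insert.1 hX with rfl | hX
    · refine ⟨hP0, hPρ, fun W' hW' h => hmin' W' hW' h fun x hx => ?_, c, hc⟩
      rw [hc x (hW' hx)]
      exact Submodule.smul_mem _ _ hx
    · exact hsP X hX
  · intro X hX Y hY hne x hx y hy
    rcases Finset.mem_insert.1 hX with rfl | hX' <;> rcases Finset.mem_insert.1 hY with rfl | hY'
    · exact absurd rfl hne
    · exact hsle Y hY' hy x hx
    · rw [hg.symm]; exact hsle X hX' hx y hy
    · exact hso X hX' Y hY' hne x hx y hy

/-- A commuting symmetric operator is scalar on the summands of some decomposition. -/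
theorem exists_decomposition [FiniteDimensional ℝ V] {g : LinearMap.BilinForm ℝ V}
    (hg : IsInvariantInner ρ g) {U : V →ₗ[ℝ] V} (hU : ∀ x y, g (U x) y = g x (U y))
    (heq : ∀ k x, U (ρ k x) = ρ k (U x)) :
    ∃ (D : Decomposition ρ g) (a : Fin D.q → ℝ), ∀ i, ∀ x ∈ D.P i, U x = a i • x := by
  obtain ⟨s, hs, hsP, hso⟩ := exists_irreducible_eigenspaces hg hU heq _ ⊤ rfl
    (fun _ _ _ => trivial) (fun _ _ => trivial)
  have hb : ∀ P : Submodule ℝ V, ∃ b : Module.Basis (Fin (Module.finrank ℝ P)) ℝ P,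
      OrthonormalFor (g.restrict P) b := fun P =>
    exists_orthonormalFor (fun x y => hg.symm x y) (fun x hx => hg.pos x (by simpa using hx))
  choose b hb using hb
  let P : Fin s.card → Submodule ℝ V := fun i => (s.equivFin.symm i : Submodule ℝ V)
  have hP : ∀ i, P i ∈ s := fun i => (s.equivFin.symm i).2
  have hdec : ∀ i, ∃ c : ℝ, ∀ x ∈ P i, U x = c • x := fun i => (hsP _ (hP i)).2.2.2
  choose a ha using hdec
  refine ⟨⟨s.card, P, fun i => (hsP _ (hP i)).2.1, fun i => (hsP _ (hP i)).2.2.1,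
    fun i j hij => hso _ (hP i) _ (hP j) fun h => hij (s.equivFin.symm.injective (Subtype.ext h)),
    ?_, fun i => Module.finrank ℝ (P i), fun i => ?_, fun i α => b (P i) α, fun i => ?_,
    fun i α β => hb (P i) α β⟩, a, ha⟩
  · rw [eq_top_iff, ← hs]
    refine Finset.sup_le fun X hX => ?_
    have : X = P (s.equivFin ⟨X, hX⟩) := by simp [P]
    rw [id, this]
    exact le_iSup P _
  · have : Nontrivial (P i) := Submodule.nontrivial_iff_ne_bot.2 (hsP _ (hP i)).1
    exact Module.finrank_pos
  · have := congrArg (Submodule.map (P i).subtype) (b (P i)).span_eq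
    rw [Submodule.map_span, ← Set.range_comp, Submodule.map_top, Submodule.range_subtype] at this
    exact this

end Schur

/-! ### Deformations that are diagonal in a decomposition -/

section Diagonal

theorem exp_mulVec_of_mulVec_eq {n : Type*} [Fintype n] [DecidableEq n] {M : Matrix n n ℝ}
    {v : n → ℝ} {c : ℝ} (h : M.mulVec v = c • v) :
    (NormedSpace.exp M).mulVec v = Real.exp c • v := by
  -- Some submultiplicative norm is needed for convergence of the exponential series, which is then
  -- applied to `v` term by term.
  let : NormedRing (Matrix n n ℝ) := Matrix.linftyOpNormedRing
  let : NormedAlgebra ℝ (Matrix n n ℝ) := Matrix.linftyOpNormedAlgebra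
  have hpow : ∀ k : ℕ, (M ^ k).mulVec v = c ^ k • v := by
    intro k
    induction k with
    | zero => simp
    | succ k ih => rw [pow_succ, ← Matrix.mulVec_mulVec, h, Matrix.mulVec_smul, ih, smul_smul,
        pow_succ, mul_comm]
  have h1 := NormedSpace.exp_series_hasSum_exp' (𝕂 := ℝ) M
  let L : Matrix n n ℝ →ₗ[ℝ] (n → ℝ) :=
    { toFun := fun A => A.mulVec v
      map_add' := fun A B => Matrix.add_mulVec A B v
      map_smul' := fun t A => Matrix.smul_mulVec t A v }
  have h2 := (LinearMap.toContinuousLinearMap L).hasSum h1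
  have h3 := (NormedSpace.exp_series_hasSum_exp' (𝕂 := ℝ) c).smul_const v
  rw [← Real.exp_eq_exp_ℝ] at h3
  have e : (fun k : ℕ => LinearMap.toContinuousLinearMap L ((k.factorial : ℝ)⁻¹ • M ^ k))
      = fun k : ℕ => ((k.factorial : ℝ)⁻¹ • c ^ k) • v := by
    funext k
    show L _ = _
    rw [map_smul, smul_assoc]
    exact congrArg _ (hpow k)
  rw [e] at h2
  exact h2.unique h3

variable {V : Type*} [AddCommGroup V] [Module ℝ V] [FiniteDimensional ℝ V]

theorem expEnd_apply_of_apply_eq {A : V →ₗ[ℝ] V} {x : V} {c : ℝ} (h : A x = c • x) :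
    expEnd A x = Real.exp c • x := by
  set b := Module.finBasis ℝ V
  apply b.equivFun.injective
  have h1 : (LinearMap.toMatrix b b A).mulVec (b.equivFun x) = c • b.equivFun x := by
    have := LinearMap.toMatrix_mulVec_repr b b A x
    rw [h] at this
    rw [Module.Basis.equivFun_apply, this]
    simp
  have h2 := exp_mulVec_of_mulVec_eq h1
  have h3 : b.equivFun (expEnd A x)
      = (NormedSpace.exp (LinearMap.toMatrix b b A)).mulVec (b.equivFun x) := by
    have := LinearMap.toMatrix_mulVec_repr b b (expEnd A) x
    rw [expEnd, LinearMap.toMatrix_toLin] at this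
    rw [Module.Basis.equivFun_apply, Module.Basis.equivFun_apply, this]
    rfl
  rw [h3, h2, map_smul]

variable {K : Type*} [Group K] {ρ : Representation ℝ K V} {g : LinearMap.BilinForm ℝ V}

namespace Decomposition

omit [FiniteDimensional ℝ V] in
theorem e_mem (D : Decomposition ρ g) (i : Fin D.q) (α : Fin (D.d i)) : D.e i α ∈ D.P i := by
  rw [← D.span_e]; exact Submodule.subset_span ⟨α, rfl⟩

omit [FiniteDimensional ℝ V] in
theorem apply_e (D : Decomposition ρ g) (p r : Σ i, Fin (D.d i)) :
    g (D.e p.1 p.2) (D.e r.1 r.2) = if p = r then 1 else 0 := by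
  obtain ⟨i, α⟩ := p
  obtain ⟨j, β⟩ := r
  by_cases hij : i = j
  · subst hij
    rw [D.orthonormal]
    simp
  · rw [D.orthogonal i j hij _ (D.e_mem i α) _ (D.e_mem j β), if_neg]
    rintro ⟨⟩
    exact hij rfl

/-- The basis of the whole space given by a decomposition. -/
def basis (D : Decomposition ρ g) : Module.Basis (Σ i, Fin (D.d i)) ℝ V :=
  Module.Basis.mk (v := fun p : Σ i, Fin (D.d i) => D.e p.1 p.2)
    (by
      rw [Fintype.linearIndependent_iff]
      intro c hc r
      have := congrArg (fun x => g x (D.e r.1 r.2)) hc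
      simpa [D.apply_e] using this)
    (by
      rw [← D.iSup_eq_top]
      refine iSup_le fun i => ?_
      rw [← D.span_e]
      refine Submodule.span_mono ?_
      rintro _ ⟨α, rfl⟩
      exact ⟨⟨i, α⟩, rfl⟩)

omit [FiniteDimensional ℝ V] in
theorem basis_apply (D : Decomposition ρ g) (p : Σ i, Fin (D.d i)) : D.basis p = D.e p.1 p.2 := by
  rw [basis, Module.Basis.mk_apply]

omit [FiniteDimensional ℝ V] in
theorem orthonormalFor_basis (D : Decomposition ρ g) : OrthonormalFor g D.basis := fun p r => by
  rw [basis_apply, basis_apply, D.apply_e]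

/-- The operator which is `a i` on `P i`. -/
def diag (D : Decomposition ρ g) (a : Fin D.q → ℝ) : V →ₗ[ℝ] V :=
  D.basis.constr ℝ fun p => a p.1 • D.basis p

omit [FiniteDimensional ℝ V] in
theorem diag_basis (D : Decomposition ρ g) (a : Fin D.q → ℝ) (p : Σ i, Fin (D.d i)) :
    D.diag a (D.basis p) = a p.1 • D.basis p := by
  rw [diag, Module.Basis.constr_basis]

omit [FiniteDimensional ℝ V] in
theorem diag_apply_of_mem (D : Decomposition ρ g) (a : Fin D.q → ℝ) {i : Fin D.q} {x : V}
    (hx : x ∈ D.P i) : D.diag a x = a i • x := by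
  rw [← D.span_e] at hx
  induction hx using Submodule.span_induction with
  | mem y hy =>
    obtain ⟨γ, rfl⟩ := hy
    have := D.diag_basis a ⟨i, γ⟩
    rwa [basis_apply] at this
  | zero => simp
  | add y z _ _ h1 h2 => rw [map_add, h1, h2, smul_add]
  | smul c y _ h => rw [map_smul, h, smul_comm]

omit [FiniteDimensional ℝ V] in
theorem eq_diag (D : Decomposition ρ g) {a : Fin D.q → ℝ} {A : V →ₗ[ℝ] V}
    (h : ∀ i, ∀ x ∈ D.P i, A x = a i • x) : A = D.diag a :=
  D.basis.ext fun p => by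
    rw [diag_basis, h p.1]
    rw [basis_apply]
    exact D.e_mem _ _

omit [FiniteDimensional ℝ V] in
theorem smul_diag_add_smul_diag (D : Decomposition ρ g) (a b : Fin D.q → ℝ) (s t : ℝ) :
    t • D.diag b + s • D.diag a = D.diag (t • b + s • a) :=
  D.basis.ext fun p => by
    simp only [LinearMap.add_apply, LinearMap.smul_apply, diag_basis, Pi.add_apply, Pi.smul_apply,
      smul_eq_mul, add_smul, mul_smul]

theorem expEnd_diag (D : Decomposition ρ g) (a : Fin D.q → ℝ) :
    expEnd (D.diag a) = D.diag fun i => Real.exp (a i) :=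
  D.basis.ext fun p => by rw [diag_basis, expEnd_apply_of_apply_eq (D.diag_basis a p)]

omit [FiniteDimensional ℝ V] in
theorem apply_diag_basis (D : Decomposition ρ g) (a : Fin D.q → ℝ) (x : V)
    (p : Σ i, Fin (D.d i)) : g (D.diag a x) (D.basis p) = a p.1 * g x (D.basis p) := by
  conv_lhs => rw [D.orthonormalFor_basis.eq_sum x]
  simp [diag_basis, D.orthonormalFor_basis.apply_basis, mul_comm]

omit [FiniteDimensional ℝ V] in
theorem trace_diag (D : Decomposition ρ g) (a : Fin D.q → ℝ) :
    LinearMap.trace ℝ V (D.diag a) = ∑ i, D.d i * a i := by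
  rw [D.orthonormalFor_basis.trace_eq]
  simp [apply_diag_basis, D.orthonormalFor_basis.apply_basis, Fintype.sum_sigma]

omit [FiniteDimensional ℝ V] in
theorem diag_symm (D : Decomposition ρ g) (a : Fin D.q → ℝ) (x y : V) :
    g (D.diag a x) y = g x (D.diag a y) := by
  have hb := D.orthonormalFor_basis
  rw [hb.symm x, hb.apply_eq_sum, hb.apply_eq_sum (D.diag a y)]
  simp only [apply_diag_basis]
  exact Finset.sum_congr rfl fun p _ => by ring

omit [FiniteDimensional ℝ V] in
theorem diag_equivariant (D : Decomposition ρ g) (a : Fin D.q → ℝ) (k : K) (x : V) :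
    D.diag a (ρ k x) = ρ k (D.diag a x) := by
  refine LinearMap.congr_fun (f := D.diag a ∘ₗ ρ k) (g := ρ k ∘ₗ D.diag a)
    (D.basis.ext fun p => ?_) x
  have h : D.basis p ∈ D.P p.1 := by rw [basis_apply]; exact D.e_mem _ _
  rw [LinearMap.comp_apply, LinearMap.comp_apply, diag_basis,
    D.diag_apply_of_mem a (D.invariant _ k _ h), map_smul]

omit [FiniteDimensional ℝ V] in
theorem isVariation_diag (D : Decomposition ρ g) {a : Fin D.q → ℝ} (ha : ∑ i, D.d i * a i = 0) :
    IsVariation ρ g (D.diag a) :=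
  ⟨D.diag_symm a, D.diag_equivariant a, by rw [trace_diag, ha]⟩

theorem deform_diag_apply (D : Decomposition ρ g) (a : Fin D.q → ℝ) (x y : V) :
    deform g (D.diag a) x y = g (D.diag (fun i => Real.exp (a i)) x) y := by
  rw [deform, LinearMap.comp_apply, expEnd_diag]

theorem deform_diag_rep (D : Decomposition ρ g) (hg : ∀ k x y, g (ρ k x) (ρ k y) = g x y)
    (a : Fin D.q → ℝ) (k : K) (x y : V) :
    deform g (D.diag a) (ρ k x) (ρ k y) = deform g (D.diag a) x y := by
  rw [deform_diag_apply, deform_diag_apply, diag_equivariant, hg]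

omit [FiniteDimensional ℝ V] in
theorem isUnit_exp (D : Decomposition ρ g) (a : Fin D.q → ℝ) (p : Σ i, Fin (D.d i)) :
    IsUnit (Real.exp (-a p.1 / 2)) := isUnit_iff_ne_zero.2 (Real.exp_pos _).ne'

/-- The orthonormal basis for the deformed form. -/
def scaledBasis (D : Decomposition ρ g) (a : Fin D.q → ℝ) :
    Module.Basis (Σ i, Fin (D.d i)) ℝ V :=
  D.basis.isUnitSMul (D.isUnit_exp a)

omit [FiniteDimensional ℝ V] in
theorem scaledBasis_apply (D : Decomposition ρ g) (a : Fin D.q → ℝ) (p : Σ i, Fin (D.d i)) :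
    D.scaledBasis a p = Real.exp (-a p.1 / 2) • D.basis p := by
  rw [scaledBasis, Module.Basis.isUnitSMul_apply]

theorem orthonormalFor_scaledBasis (D : Decomposition ρ g) (a : Fin D.q → ℝ) :
    OrthonormalFor (deform g (D.diag a)) (D.scaledBasis a) := by
  intro p r
  rw [deform_diag_apply, scaledBasis_apply, scaledBasis_apply, map_smul, map_smul,
    map_smul, LinearMap.smul_apply, apply_diag_basis, D.orthonormalFor_basis.apply_basis]
  split_ifs with h
  · subst h
    simp only [smul_eq_mul, mul_one, ← Real.exp_add]
    rw [← Real.exp_zero]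
    congr 1
    ring
  · simp

end Decomposition

end Diagonal

/-! ### The scalar curvature of diagonal metrics -/

section DiagonalCurvature

variable {𝔤 : Type*} [LieRing 𝔤] [LieAlgebra ℝ 𝔤] [FiniteDimensional ℝ 𝔤] {𝔭 : Submodule ℝ 𝔤}
  {π : 𝔤 →ₗ[ℝ] 𝔭} {K : Type*} [Group K] {ρ : Representation ℝ K 𝔭}
  {g : LinearMap.BilinForm ℝ 𝔭}

namespace Decomposition

omit [FiniteDimensional ℝ 𝔤] in
theorem coeff_eq (D : Decomposition ρ g) (k i j : Fin D.q) :
    D.coeff π k i j = ∑ α, ∑ β, ∑ γ,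
      structureConstant π g D.basis ⟨i, α⟩ ⟨j, β⟩ ⟨k, γ⟩ ^ 2 := by
  simp only [coeff, structureConstant, basis_apply]

omit [FiniteDimensional ℝ 𝔤] in
theorem coeff_comm (D : Decomposition ρ g) (k i j : Fin D.q) :
    D.coeff π k i j = D.coeff π k j i := by
  rw [coeff_eq, coeff_eq, Finset.sum_comm]
  simp only [structureConstant_swap π g D.basis ⟨i, _⟩ ⟨j, _⟩, neg_sq]

/-- The scalar curvature of the metric which is `e^{a i}` times `g` on `P i`. -/
def diagScalar (D : Decomposition ρ g) (π : 𝔤 →ₗ[ℝ] 𝔭) (a : Fin D.q → ℝ) : ℝ :=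
  -(1 / 2) * ∑ i, D.killingValue i * D.d i * Real.exp (-a i)
    - 1 / 4 * ∑ i, ∑ j, ∑ k, D.coeff π k i j * Real.exp (a k - a i - a j)

/-- By Schur the invariant Killing form is a multiple of `g` on each irreducible summand. This
justifies reading off `killingValue` from the first basis vector. -/
theorem killingForm_e (hg : IsInvariantInner ρ g)
    (hkill : ∀ (k : K) (x y : 𝔭), killingForm ℝ 𝔤 (ρ k x : 𝔤) (ρ k y : 𝔤)
      = killingForm ℝ 𝔤 (x : 𝔤) (y : 𝔤))
    (D : Decomposition ρ g) (i : Fin D.q) (α : Fin (D.d i)) :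
    killingForm ℝ 𝔤 (D.e i α : 𝔤) (D.e i α : 𝔤) = D.killingValue i := by
  obtain ⟨c, hc⟩ := exists_eq_mul_of_irreducible hg
    (β := (killingForm ℝ 𝔤).restrict 𝔭) (fun x y => LieModule.traceForm_comm ℝ 𝔤 𝔤 x y) hkill
    (D.invariant i) (D.irreducible i)
  have h := fun α => hc _ (D.e_mem i α) _ (D.e_mem i α)
  simp only [D.orthonormal, if_true] at h
  exact (h α).trans (h _).symm

/-- The vectors `e^{-a i / 2} e` are orthonormal for the new metric. This multiplies Killing values
by `e^{-a i}` and squared structure constants by `e^{a k - a i - a j}`. The deformed form is still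
invariant, which is why `hskew` is required for every invariant form and not only for `g`. -/
theorem scalarCurvature_deform_diag (hπ : IsReductive π) (hg : IsInvariantInner ρ g)
    (hskew : ∀ β : LinearMap.BilinForm ℝ 𝔭, (∀ k x y, β (ρ k x) (ρ k y) = β x y) → IsKerSkew π β)
    (hkill : ∀ (k : K) (x y : 𝔭), killingForm ℝ 𝔤 (ρ k x : 𝔤) (ρ k y : 𝔤)
      = killingForm ℝ 𝔤 (x : 𝔤) (y : 𝔤))
    (D : Decomposition ρ g) (a : Fin D.q → ℝ) :
    scalarCurvature π (deform g (D.diag a)) = D.diagScalar π a := by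
  rw [scalarCurvature_eq hπ (hskew _ (D.deform_diag_rep hg.inv a))
    (D.orthonormalFor_scaledBasis a), diagScalar]
  have hc : ∀ p r s, structureConstant π (deform g (D.diag a)) (D.scaledBasis a) p r s ^ 2
      = structureConstant π g D.basis p r s ^ 2 * Real.exp (a s.1 - a p.1 - a r.1) := by
    intro p r s
    rw [structureConstant, deform_diag_apply, scaledBasis_apply, scaledBasis_apply,
      scaledBasis_apply, map_smul, apply_diag_basis]
    simp only [Submodule.coe_smul, smul_lie, lie_smul, map_smul, LinearMap.smul_apply,
      smul_eq_mul]
    change (_ * (_ * (_ * (_ * structureConstant π g D.basis p r s)))) ^ 2 = _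
    have : Real.exp (a s.1 - a p.1 - a r.1) = (Real.exp (-a s.1 / 2) * Real.exp (a s.1)
        * Real.exp (-a p.1 / 2) * Real.exp (-a r.1 / 2)) ^ 2 := by
      rw [← Real.exp_add, ← Real.exp_add, ← Real.exp_add, ← Real.exp_nat_mul]
      congr 1
      push_cast
      ring
    rw [this]
    ring
  congr 1
  · congr 1
    rw [Fintype.sum_sigma]
    refine Finset.sum_congr rfl fun i _ => ?_
    have : ∀ α, killingForm ℝ 𝔤 (D.scaledBasis a ⟨i, α⟩ : 𝔤) (D.scaledBasis a ⟨i, α⟩ : 𝔤)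
        = D.killingValue i * Real.exp (-a i) := by
      intro α
      rw [scaledBasis_apply, basis_apply]
      simp only [Submodule.coe_smul, map_smul, LinearMap.smul_apply, smul_eq_mul,
        D.killingForm_e hg hkill]
      rw [← mul_assoc, ← Real.exp_add, mul_comm]
      congr 2
      ring
    simp only [this]
    simp
    ring
  · congr 1
    simp only [hc]
    rw [Fintype.sum_sigma]
    refine Finset.sum_congr rfl fun i _ => ?_
    simp only [Fintype.sum_sigma]
    rw [Finset.sum_comm]
    refine Finset.sum_congr rfl fun j _ => ?_
    have : ∀ k, D.coeff π k i j * Real.exp (a k - a i - a j) = ∑ α, ∑ β, ∑ γ,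
        structureConstant π g D.basis ⟨i, α⟩ ⟨j, β⟩ ⟨k, γ⟩ ^ 2 * Real.exp (a k - a i - a j) := by
      intro k
      rw [coeff_eq]
      simp only [Finset.sum_mul]
    simp only [this]
    -- The sum over the third summand `k` is moved inside the sums over the basis vectors `α` and
    -- `β`.
    rw [Finset.sum_comm (s := Finset.univ (α := Fin D.q))]
    refine Finset.sum_congr rfl fun α _ => ?_
    rw [Finset.sum_comm (s := Finset.univ (α := Fin D.q))]

end Decomposition

end DiagonalCurvature

/-! ### First and second variation along diagonal metrics -/

section Hessian

/-- The matrix `F` represents the second derivative of a sum of exponentials. -/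
theorem sum_mul_sub_sub_mul_sub_sub {ι : Type*} [Fintype ι] [DecidableEq ι] (C : ι → ι → ι → ℝ)
    (hC : ∀ k i j, C k i j = C k j i) (a b : ι → ℝ) :
    ∑ i, ∑ j, ∑ k, C k i j * ((a k - a i - a j) * (b k - b i - b j))
      = ∑ i, b i * a i * ∑ m, ∑ k, (C i k m + 2 * C k i m)
        - 2 * ∑ i, ∑ j, ∑ k, b i * a j * (C j i k + C i k j - C k i j) := by
  -- Of the nine products in the expansion, those differing by the exchange of `i` and `j` agree by
  -- symmetry of `C` in its last two indices; the others are matched with the right-hand side by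
  -- cyclic relabelling.
  have swap : ∀ f : ι → ι → ι → ℝ, ∑ i, ∑ j, ∑ k, f i j k = ∑ i, ∑ j, ∑ k, f j i k :=
    fun f => Finset.sum_comm
  have e1 := swap fun i j k => C k i j * (a j * b j)
  have e2 := swap fun i j k => C k i j * (a k * b j)
  have e3 := swap fun i j k => C k i j * (a i * b k)
  have e4 := swap fun i j k => C k i j * (a i * b j)
  have f1 : ∑ i, b i * a i * ∑ m, ∑ k, (C i k m + 2 * C k i m)
      = ∑ i, ∑ j, ∑ k, C i k j * (a i * b i) + 2 * ∑ i, ∑ j, ∑ k, C k i j * (a i * b i) := by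
    simp only [Finset.mul_sum, ← Finset.sum_add_distrib]
    exact Finset.sum_congr rfl fun i _ => Finset.sum_congr rfl fun j _ =>
      Finset.sum_congr rfl fun k _ => by ring
  have f2 : ∑ i, ∑ j, ∑ k, C i k j * (a i * b i) = ∑ i, ∑ j, ∑ k, C k i j * (a k * b k) := by
    rw [← sum_cyclic fun i j k => C k i j * (a k * b k)]
    exact Finset.sum_congr rfl fun i _ => Finset.sum_congr rfl fun j _ =>
      Finset.sum_congr rfl fun k _ => by rw [hC]
  have f3 : ∑ i, ∑ j, ∑ k, b i * a j * (C j i k + C i k j - C k i j)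
      = ∑ i, ∑ j, ∑ k, C k i j * (a k * b i) + ∑ i, ∑ j, ∑ k, C k i j * (a j * b k)
        - ∑ i, ∑ j, ∑ k, C k i j * (a j * b i) := by
    have g1 : ∑ i, ∑ j, ∑ k, C k i j * (a k * b i) = ∑ i, ∑ j, ∑ k, C j i k * (a j * b i) :=
      Finset.sum_congr rfl fun i _ => Finset.sum_comm
    have g2 : ∑ i, ∑ j, ∑ k, C k i j * (a j * b k) = ∑ i, ∑ j, ∑ k, C i k j * (a j * b i) := by
      rw [← sum_cyclic fun i j k => C k i j * (a j * b k)]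
      refine Finset.sum_congr rfl fun i _ => ?_
      rw [Finset.sum_comm]
    rw [g1, g2]
    simp only [← Finset.sum_add_distrib, ← Finset.sum_sub_distrib]
    exact Finset.sum_congr rfl fun i _ => Finset.sum_congr rfl fun j _ =>
      Finset.sum_congr rfl fun k _ => by ring
  have f4 : ∑ i, ∑ j, ∑ k, C k i j * ((a k - a i - a j) * (b k - b i - b j))
      = ∑ i, ∑ j, ∑ k, C k i j * (a k * b k) + ∑ i, ∑ j, ∑ k, C k i j * (a i * b i)
        + ∑ i, ∑ j, ∑ k, C k i j * (a j * b j) - ∑ i, ∑ j, ∑ k, C k i j * (a k * b i)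
        - ∑ i, ∑ j, ∑ k, C k i j * (a k * b j) - ∑ i, ∑ j, ∑ k, C k i j * (a i * b k)
        - ∑ i, ∑ j, ∑ k, C k i j * (a j * b k) + ∑ i, ∑ j, ∑ k, C k i j * (a i * b j)
        + ∑ i, ∑ j, ∑ k, C k i j * (a j * b i) := by
    simp only [← Finset.sum_add_distrib, ← Finset.sum_sub_distrib]
    exact Finset.sum_congr rfl fun i _ => Finset.sum_congr rfl fun j _ =>
      Finset.sum_congr rfl fun k _ => by ring
  have h : ∀ i j k, C k j i = C k i j := fun i j k => hC k j i
  simp only [h] at e1 e2 e3 e4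
  linarith

variable {𝔤 : Type*} [LieRing 𝔤] [LieAlgebra ℝ 𝔤] [FiniteDimensional ℝ 𝔤] {𝔭 : Submodule ℝ 𝔤}
  {π : 𝔤 →ₗ[ℝ] 𝔭} {K : Type*} [Group K] {ρ : Representation ℝ K 𝔭}
  {g : LinearMap.BilinForm ℝ 𝔭}

namespace Decomposition

/-- The derivative of `diagScalar` at `x` in the direction `b`. -/
def diagGrad (D : Decomposition ρ g) (π : 𝔤 →ₗ[ℝ] 𝔭) (x b : Fin D.q → ℝ) : ℝ :=
  1 / 2 * ∑ i, D.killingValue i * D.d i * (b i * Real.exp (-x i))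
    - 1 / 4 * ∑ i, ∑ j, ∑ k, D.coeff π k i j *
      ((b k - b i - b j) * Real.exp (x k - x i - x j))

/-- The second derivative of `diagScalar` at `0`. -/
def diagHess (D : Decomposition ρ g) (π : 𝔤 →ₗ[ℝ] 𝔭) (a b : Fin D.q → ℝ) : ℝ :=
  -(1 / 2) * ∑ i, D.killingValue i * D.d i * (a i * b i)
    - 1 / 4 * ∑ i, ∑ j, ∑ k, D.coeff π k i j * ((a k - a i - a j) * (b k - b i - b j))

omit [FiniteDimensional ℝ 𝔤] in
theorem hasDerivAt_diagScalar (D : Decomposition ρ g) (x b : Fin D.q → ℝ) :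
    HasDerivAt (fun t : ℝ => D.diagScalar π (t • b + x)) (D.diagGrad π x b) 0 := by
  have h : ∀ u v : ℝ, HasDerivAt (fun t : ℝ => Real.exp (t * u + v)) (u * Real.exp v) 0 := by
    intro u v
    have := (((hasDerivAt_id (0 : ℝ)).mul_const u).add_const v).exp
    simpa [mul_comm] using this
  have h1 : ∀ i, HasDerivAt
      (fun t : ℝ => D.killingValue i * D.d i * Real.exp (-(t • b + x) i))
      (D.killingValue i * D.d i * ((-b i) * Real.exp (-x i))) 0 := fun i => by
    refine HasDerivAt.const_mul _ ?_
    refine (h (-b i) (-x i)).congr_of_eventuallyEq (.of_forall fun t => congrArg Real.exp ?_)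
    simp only [Pi.add_apply, Pi.smul_apply, smul_eq_mul]
    ring
  have h2 : ∀ i j k, HasDerivAt (fun t : ℝ => D.coeff π k i j *
      Real.exp ((t • b + x) k - (t • b + x) i - (t • b + x) j))
      (D.coeff π k i j * ((b k - b i - b j) * Real.exp (x k - x i - x j))) 0 := fun i j k => by
    refine HasDerivAt.const_mul _ ?_
    refine (h (b k - b i - b j) (x k - x i - x j)).congr_of_eventuallyEq (.of_forall fun t => congrArg Real.exp ?_)
    simp only [Pi.add_apply, Pi.smul_apply, smul_eq_mul]
    ring
  unfold diagScalar
  refine (((HasDerivAt.fun_sum fun i _ => h1 i).const_mul (-(1 / 2))).fun_sub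
    ((HasDerivAt.fun_sum fun i _ => HasDerivAt.fun_sum fun j _ => HasDerivAt.fun_sum fun k _ =>
      h2 i j k).const_mul (1 / 4))).congr_deriv ?_
  unfold diagGrad
  congr 1
  simp only [Finset.mul_sum]
  exact Finset.sum_congr rfl fun i _ => by ring

omit [FiniteDimensional ℝ 𝔤] in
theorem hasDerivAt_diagGrad (D : Decomposition ρ g) (a b : Fin D.q → ℝ) :
    HasDerivAt (fun s : ℝ => D.diagGrad π (s • a) b) (D.diagHess π a b) 0 := by
  have h : ∀ u : ℝ, HasDerivAt (fun t : ℝ => Real.exp (t * u)) u 0 := by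
    intro u
    have := ((hasDerivAt_id (0 : ℝ)).mul_const u).exp
    simpa using this
  have h1 : ∀ i, HasDerivAt
      (fun s : ℝ => D.killingValue i * D.d i * (b i * Real.exp (-(s • a) i)))
      (D.killingValue i * D.d i * (b i * (-a i))) 0 := fun i => by
    refine HasDerivAt.const_mul _ (HasDerivAt.const_mul _ ?_)
    refine (h (-a i)).congr_of_eventuallyEq (.of_forall fun t => congrArg Real.exp ?_)
    simp only [Pi.smul_apply, smul_eq_mul]
    ring
  have h2 : ∀ i j k, HasDerivAt (fun s : ℝ => D.coeff π k i j *
      ((b k - b i - b j) * Real.exp ((s • a) k - (s • a) i - (s • a) j)))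
      (D.coeff π k i j * ((b k - b i - b j) * (a k - a i - a j))) 0 := fun i j k => by
    refine HasDerivAt.const_mul _ (HasDerivAt.const_mul _ ?_)
    refine (h (a k - a i - a j)).congr_of_eventuallyEq (.of_forall fun t => congrArg Real.exp ?_)
    simp only [Pi.smul_apply, smul_eq_mul]
    ring
  unfold diagGrad
  refine (((HasDerivAt.fun_sum fun i _ => h1 i).const_mul (1 / 2)).fun_sub
    ((HasDerivAt.fun_sum fun i _ => HasDerivAt.fun_sum fun j _ => HasDerivAt.fun_sum fun k _ =>
      h2 i j k).const_mul (1 / 4))).congr_deriv ?_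
  unfold diagHess
  congr 1
  · simp only [Finset.mul_sum]
    exact Finset.sum_congr rfl fun i _ => by ring
  · simp only [mul_comm (b _ - b _ - b _)]

omit [FiniteDimensional ℝ 𝔤] in
-- Every exponent in `diagScalar` drops by `s` under `a ↦ a + s·1`, so the function is homogeneous
-- of degree `-1` in this sense, and so is its gradient.
theorem diagHess_one (D : Decomposition ρ g) (b : Fin D.q → ℝ) :
    D.diagHess π 1 b = - D.diagGrad π 0 b := by
  simp only [diagHess, diagGrad, Pi.one_apply, Pi.zero_apply, neg_zero, Real.exp_zero,
    mul_one, one_mul, sub_self, zero_sub, mul_neg, neg_mul, Finset.sum_neg_distrib]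
  ring

omit [FiniteDimensional ℝ 𝔤] in
-- The last summand of a diagonal entry of `F` is the off-diagonal formula evaluated at `i = j`.
-- Hence `F` is a diagonal matrix plus one uniform expression, and the expansion
-- `sum_mul_sub_sub_mul_sub_sub` matches it with the second derivative.
theorem diagHess_eq (D : Decomposition ρ g) (a b : Fin D.q → ℝ) :
    D.diagHess π a b = b ⬝ᵥ (D.matrixF π).mulVec a := by
  have hF : ∀ i j, D.matrixF π i j
      = (if i = j then -(D.killingValue i * D.d i / 2)
          - 1 / 4 * ∑ m, ∑ k, (D.coeff π i k m + 2 * D.coeff π k i m) else 0)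
        + 1 / 2 * ∑ k, (D.coeff π j i k + D.coeff π i k j - D.coeff π k i j) := by
    intro i j
    rw [matrixF, Matrix.of_apply]
    split_ifs with h
    · subst h
      have : ∀ k, D.coeff π i i k + D.coeff π i k i - D.coeff π k i i
          = - (D.coeff π k i i - 2 * D.coeff π i i k) := fun k => by
        rw [D.coeff_comm i k i]; ring
      simp only [this, Finset.sum_neg_distrib]
      ring
    · ring
  have h1 : b ⬝ᵥ (D.matrixF π).mulVec a
      = ∑ i, b i * a i * (-(D.killingValue i * D.d i / 2)
          - 1 / 4 * ∑ m, ∑ k, (D.coeff π i k m + 2 * D.coeff π k i m))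
        + 1 / 2 * ∑ i, ∑ j, ∑ k,
          b i * a j * (D.coeff π j i k + D.coeff π i k j - D.coeff π k i j) := by
    simp only [dotProduct, Matrix.mulVec, hF, add_mul, ite_mul, zero_mul, Finset.sum_add_distrib,
      Finset.sum_ite_eq, Finset.mem_univ, if_true, mul_add]
    congr 1
    · exact Finset.sum_congr rfl fun i _ => by ring
    · simp only [Finset.mul_sum, Finset.sum_mul]
      exact Finset.sum_congr rfl fun i _ => Finset.sum_congr rfl fun j _ =>
        Finset.sum_congr rfl fun k _ => by ring
  rw [h1, diagHess, sum_mul_sub_sub_mul_sub_sub (D.coeff π) D.coeff_comm]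
  simp only [mul_sub, Finset.sum_sub_distrib]
  have h2 : ∑ i, b i * a i * (1 / 4 * ∑ m, ∑ k, (D.coeff π i k m + 2 * D.coeff π k i m))
      = 1 / 4 * ∑ i, b i * a i * ∑ m, ∑ k, (D.coeff π i k m + 2 * D.coeff π k i m) := by
    rw [Finset.mul_sum]
    exact Finset.sum_congr rfl fun i _ => by ring
  have h3 : ∑ i, b i * a i * (-(D.killingValue i * D.d i / 2))
      = -(1 / 2) * ∑ i, D.killingValue i * D.d i * (a i * b i) := by
    rw [Finset.mul_sum]
    exact Finset.sum_congr rfl fun i _ => by ring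
  rw [h2, h3]
  ring

omit [FiniteDimensional ℝ 𝔤] in
theorem dotProduct_matrixF_comm (D : Decomposition ρ g) (a b : Fin D.q → ℝ) :
    b ⬝ᵥ (D.matrixF π).mulVec a = a ⬝ᵥ (D.matrixF π).mulVec b := by
  rw [← diagHess_eq, ← diagHess_eq]
  simp only [diagHess, mul_comm (a _), mul_comm (a _ - a _ - a _)]

end Decomposition

/-- The double orthogonal complement of a line is the line: the component of `w` orthogonal to `d`
is orthogonal to both `d` and `w`, hence to itself. For `d = 0` the hypothesis gives `w · w = 0`. -/
theorem exists_eq_smul_of_dotProduct {n : Type*} [Fintype n] {d w : n → ℝ}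
    (h : ∀ b, d ⬝ᵥ b = 0 → b ⬝ᵥ w = 0) : ∃ c : ℝ, w = c • d := by
  by_cases hd : d ⬝ᵥ d = 0
  · rw [dotProduct_self_eq_zero] at hd
    subst hd
    exact ⟨0, by rw [zero_smul]; exact dotProduct_self_eq_zero.1 (h w (zero_dotProduct w))⟩
  · refine ⟨d ⬝ᵥ w / d ⬝ᵥ d, ?_⟩
    set c := d ⬝ᵥ w / d ⬝ᵥ d with hc
    have h1 : d ⬝ᵥ (w - c • d) = 0 := by
      rw [dotProduct_sub, dotProduct_smul, smul_eq_mul, hc, div_mul_cancel₀ _ hd, sub_self]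
    have h2 : (w - c • d) ⬝ᵥ (w - c • d) = 0 := by
      rw [dotProduct_sub, dotProduct_smul, h _ h1, dotProduct_comm _ d, h1]
      simp
    exact sub_eq_zero.1 (dotProduct_self_eq_zero.1 h2)

/-! ### Critical points, trace-free vectors and the kernel of `F`. -/

section Variation

variable {F : LinearMap.BilinForm ℝ 𝔭 → ℝ} {v : ℝ}

namespace Decomposition

/-- The dimensions of the summands, as a real vector. -/
def dims (D : Decomposition ρ g) : Fin D.q → ℝ := fun i => D.d i

theorem deriv_diag (D : Decomposition ρ g) (hF : ∀ a, F (deform g (D.diag a)) = D.diagScalar π a)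
    (a b : Fin D.q → ℝ) (s : ℝ) :
    HasDerivAt (fun t : ℝ => F (deform g (t • D.diag b + s • D.diag a)))
      (D.diagGrad π (s • a) b) 0 := by
  simp only [D.smul_diag_add_smul_diag, hF]
  exact D.hasDerivAt_diagScalar _ _

/-- Diagonal operators form a linear space, so the two-parameter family never leaves the diagonal
metrics and its mixed derivative is that of `diagScalar`. -/
theorem hasDerivAt_deriv_diag (D : Decomposition ρ g)
    (hF : ∀ a, F (deform g (D.diag a)) = D.diagScalar π a) (a b : Fin D.q → ℝ) :
    HasDerivAt (fun s : ℝ => deriv (fun t : ℝ => F (deform g (t • D.diag b + s • D.diag a))) 0)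
      (b ⬝ᵥ (D.matrixF π).mulVec a) 0 := by
  simp only [(D.deriv_diag hF a b _).deriv]
  rw [← diagHess_eq]
  exact D.hasDerivAt_diagGrad a b

omit [FiniteDimensional ℝ 𝔤] in
theorem isVariation_of_dims (D : Decomposition ρ g) {b : Fin D.q → ℝ} (hb : D.dims ⬝ᵥ b = 0) :
    IsVariation ρ g (D.diag b) := D.isVariation_diag hb

/-- At a critical point, `F` applied to the constant vector is a multiple of the dimensions. -/
theorem exists_mulVec_one_eq (D : Decomposition ρ g)
    (hF : ∀ a, F (deform g (D.diag a)) = D.diagScalar π a) (hcrit : IsCriticalPoint F ρ v g) :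
    ∃ c : ℝ, (D.matrixF π).mulVec 1 = c • D.dims := by
  refine exists_eq_smul_of_dotProduct fun b hb => ?_
  rw [← diagHess_eq, diagHess_one, neg_eq_zero]
  have h1 := hcrit.2 _ (D.isVariation_of_dims hb)
  have h2 := D.deriv_diag hF 0 b 0
  simp only [zero_smul, add_zero] at h2
  exact h2.unique h1

omit [FiniteDimensional ℝ 𝔤] in
theorem diag_ne_zero (D : Decomposition ρ g) {a : Fin D.q → ℝ} (ha : a ≠ 0) : D.diag a ≠ 0 := by
  obtain ⟨i, hi⟩ := Function.ne_iff.1 ha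
  intro h
  have h1 := D.diag_basis a ⟨i, ⟨0, D.d_pos i⟩⟩
  rw [h, LinearMap.zero_apply] at h1
  exact (smul_ne_zero hi (D.basis.ne_zero _)) h1.symm

omit [FiniteDimensional ℝ 𝔤] in
theorem diag_zero (D : Decomposition ρ g) : D.diag 0 = 0 :=
  D.basis.ext fun p => by rw [diag_basis]; simp

omit [FiniteDimensional ℝ 𝔤] in
theorem dims_dotProduct_one_pos (D : Decomposition ρ g) (i : Fin D.q) : 0 < D.dims ⬝ᵥ 1 := by
  rw [dotProduct_one]
  exact Finset.sum_pos (fun i _ => Nat.cast_pos.2 (D.d_pos i)) ⟨i, Finset.mem_univ i⟩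

/-- If a nonzero diagonal variation is in the kernel of the second variation, `F` is singular. -/
theorem det_matrixF_eq_zero (D : Decomposition ρ g)
    (hF : ∀ a, F (deform g (D.diag a)) = D.diagScalar π a) (hcrit : IsCriticalPoint F ρ v g)
    {a : Fin D.q → ℝ} (ha : a ≠ 0) (hda : D.dims ⬝ᵥ a = 0)
    (hker : ∀ B, IsVariation ρ g B →
      HasDerivAt (fun s : ℝ => deriv (fun t : ℝ => F (deform g (t • B + s • D.diag a))) 0) 0 0) :
    (D.matrixF π).det = 0 := by
  obtain ⟨i, -⟩ := Function.ne_iff.1 ha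
  obtain ⟨ν, hν⟩ := D.exists_mulVec_one_eq hF hcrit
  obtain ⟨μ, hμ⟩ : ∃ c : ℝ, (D.matrixF π).mulVec a = c • D.dims :=
    exists_eq_smul_of_dotProduct fun b hb =>
      (D.hasDerivAt_deriv_diag hF a b).unique (hker _ (D.isVariation_of_dims hb))
  have hpos := D.dims_dotProduct_one_pos i
  rw [← Matrix.exists_mulVec_eq_zero_iff]
  -- `F 1 = ν d` and `F a = μ d`. If `ν = 0` the kernel contains `1`; otherwise it contains `a -
  -- (μ/ν) 1`, which is nonzero since `d · a = 0 < d · 1` and `a ≠ 0`.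
  by_cases h0 : ν = 0
  · refine ⟨1, fun h => ?_, by rw [hν, h0, zero_smul]⟩
    rw [h, dotProduct_zero] at hpos
    exact hpos.false
  · refine ⟨a - (μ / ν) • 1, fun h => ?_, ?_⟩
    · rw [sub_eq_zero] at h
      rw [h, dotProduct_smul, smul_eq_mul, mul_eq_zero] at hda
      rcases hda with h1 | h1
      · rw [h1, zero_smul] at h
        exact ha h
      · exact hpos.ne' h1
    · rw [Matrix.mulVec_sub, Matrix.mulVec_smul, hν, hμ, smul_smul, div_mul_cancel₀ _ h0, sub_self]

/-- If every variation is diagonal, the scalar curvature does not vanish, and `F` is singular, then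
the critical point is degenerate. -/
theorem isDegenerateCriticalPoint (D : Decomposition ρ g)
    (hF : ∀ a, F (deform g (D.diag a)) = D.diagScalar π a) (hcrit : IsCriticalPoint F ρ v g)
    (hdiag : ∀ B, IsVariation ρ g B → ∃ b, B = D.diag b)
    (hne : (D.matrixF π).mulVec 1 ≠ 0) (hdet : (D.matrixF π).det = 0) :
    IsDegenerateCriticalPoint F ρ v g := by
  obtain ⟨ν, hν⟩ := D.exists_mulVec_one_eq hF hcrit
  obtain ⟨a, ha, hFa⟩ := Matrix.exists_mulVec_eq_zero_iff.2 hdet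
  have hν0 : ν ≠ 0 := by
    rintro rfl
    exact hne (by rw [hν, zero_smul])
  -- By symmetry of `F`, `ν (d · a) = (F 1) · a = 1 · (F a) = 0`.
  have hda : D.dims ⬝ᵥ a = 0 := by
    have := D.dotProduct_matrixF_comm (π := π) 1 a
    rw [hν, hFa, dotProduct_zero, dotProduct_smul, smul_eq_mul, dotProduct_comm] at this
    exact (mul_eq_zero.1 this).resolve_left hν0
  refine ⟨hcrit, D.diag a, D.isVariation_of_dims hda, D.diag_ne_zero ha, fun B hB => ?_⟩
  obtain ⟨b, rfl⟩ := hdiag B hB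
  have := D.hasDerivAt_deriv_diag hF a b
  rwa [hFa, dotProduct_zero] at this

end Decomposition

end Variation

end Hessian

/-! ### Vanishing Ricci curvature forces the complement to be central -/

section Bochner

variable {𝔤 : Type*} [LieRing 𝔤] [LieAlgebra ℝ 𝔤] [FiniteDimensional ℝ 𝔤] {𝔭 : Submodule ℝ 𝔤}
  {π : 𝔤 →ₗ[ℝ] 𝔭}

/-- An ad-invariant inner product for which `ker π` is orthogonal to `𝔭`. -/
structure IsAdInvariantInner (π : 𝔤 →ₗ[ℝ] 𝔭) (Q : LinearMap.BilinForm ℝ 𝔤) : Prop where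
  symm : ∀ x y, Q x y = Q y x
  pos : ∀ x, x ≠ 0 → 0 < Q x x
  skew : ∀ x y z : 𝔤, Q ⁅x, y⁆ z + Q y ⁅x, z⁆ = 0
  orthogonal : ∀ h, π h = 0 → ∀ y : 𝔭, Q h y = 0

variable {Q : LinearMap.BilinForm ℝ 𝔤}

omit [FiniteDimensional ℝ 𝔤] in
theorem IsAdInvariantInner.nonneg (hQ : IsAdInvariantInner π Q) (x : 𝔤) : 0 ≤ Q x x := by
  by_cases h : x = 0
  · simp [h]
  · exact (hQ.pos x h).le

omit [FiniteDimensional ℝ 𝔤] in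
theorem IsAdInvariantInner.eq_zero (hQ : IsAdInvariantInner π Q) {x : 𝔤} (h : Q x x = 0) :
    x = 0 := by
  by_contra h0
  exact (hQ.pos x h0).ne' h

omit [FiniteDimensional ℝ 𝔤] in
theorem IsAdInvariantInner.proj_left (hQ : IsAdInvariantInner π Q) (hπ : IsReductive π) (x : 𝔤)
    (y : 𝔭) : Q (π x) y = Q x y := by
  have h := hQ.orthogonal _ (hπ.proj_kerPart x) y
  rw [kerPart_apply, map_sub, LinearMap.sub_apply, sub_eq_zero] at h
  exact h.symm

variable {ι : Type*} [Fintype ι] [DecidableEq ι] {b : Module.Basis ι ℝ 𝔭}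

/-- Skewness of `ad x` for `Q` turns both traces of `killingForm_eq` into negatives of squared
lengths, of the `𝔭`- and `ker π`-parts of `[x, b i]`. -/
theorem killingForm_eq_neg_sum (hQ : IsAdInvariantInner π Q) (hπ : IsReductive π)
    (hb : OrthonormalFor (Q.restrict 𝔭) b) (x : 𝔭) :
    killingForm ℝ 𝔤 (x : 𝔤) (x : 𝔤)
      = - ∑ i, (Q (π ⁅(x : 𝔤), (b i : 𝔤)⁆) (π ⁅(x : 𝔤), (b i : 𝔤)⁆)
        + 2 * Q (kerPart π ⁅(x : 𝔤), (b i : 𝔤)⁆) (kerPart π ⁅(x : 𝔤), (b i : 𝔤)⁆)) := by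
  rw [hπ.killingForm_eq, hb.trace_eq, hb.trace_eq, Finset.mul_sum, ← Finset.sum_add_distrib,
    ← Finset.sum_neg_distrib]
  refine Finset.sum_congr rfl fun i _ => ?_
  set w := ⁅(x : 𝔤), (b i : 𝔤)⁆ with hw
  have h1 : (Q.restrict 𝔭) ((bracketP π x ∘ₗ bracketP π x) (b i)) (b i)
      = - Q (π w) (π w) := by
    have e1 : (Q.restrict 𝔭) ((bracketP π x ∘ₗ bracketP π x) (b i)) (b i)
        = Q (π ⁅(x : 𝔤), (π w : 𝔤)⁆) (b i) := rfl
    have e2 := hQ.skew x (π w) (b i)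
    rw [e1, hQ.proj_left hπ]
    have e3 : Q (π w) (π w) = Q (π w) w := by
      rw [hQ.proj_left hπ, hQ.symm]
    rw [e3]
    linarith
  have h2 : (Q.restrict 𝔭) ((π ∘ₗ LieAlgebra.ad ℝ 𝔤 x ∘ₗ kerPart π ∘ₗ LieAlgebra.ad ℝ 𝔤 x
      ∘ₗ 𝔭.subtype) (b i)) (b i) = - Q (kerPart π w) (kerPart π w) := by
    have e1 : (Q.restrict 𝔭) ((π ∘ₗ LieAlgebra.ad ℝ 𝔤 x ∘ₗ kerPart π ∘ₗ LieAlgebra.ad ℝ 𝔤 x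
      ∘ₗ 𝔭.subtype) (b i)) (b i) = Q (π ⁅(x : 𝔤), kerPart π w⁆) (b i) := rfl
    have e2 := hQ.skew x (kerPart π w) (b i)
    rw [e1, hQ.proj_left hπ]
    have e3 : Q (kerPart π w) (kerPart π w) = Q (kerPart π w) w := by
      have := hQ.orthogonal _ (hπ.proj_kerPart w) (π w)
      conv_lhs => rw [kerPart_apply, map_sub, ← kerPart_apply, this, sub_zero]
    rw [e3]
    linarith
  rw [h1, h2]
  ring

/-- The isotropy contributions to `-B(x, x)` are nonnegative and are discarded. -/
theorem sum_sq_le_neg_killingForm (hQ : IsAdInvariantInner π Q) (hπ : IsReductive π)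
    (hb : OrthonormalFor (Q.restrict 𝔭) b) (x : 𝔭) :
    ∑ i, ∑ j, Q ⁅(x : 𝔤), (b i : 𝔤)⁆ (b j) ^ 2 ≤ - killingForm ℝ 𝔤 (x : 𝔤) (x : 𝔤) := by
  rw [killingForm_eq_neg_sum hQ hπ hb, neg_neg]
  refine Finset.sum_le_sum fun i _ => ?_
  have h1 : Q (π ⁅(x : 𝔤), (b i : 𝔤)⁆) (π ⁅(x : 𝔤), (b i : 𝔤)⁆)
      = ∑ j, Q ⁅(x : 𝔤), (b i : 𝔤)⁆ (b j) ^ 2 := by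
    refine (hb.apply_eq_sum (π ⁅(x : 𝔤), (b i : 𝔤)⁆) (π ⁅(x : 𝔤), (b i : 𝔤)⁆)).trans ?_
    refine Finset.sum_congr rfl fun j _ => ?_
    have : (Q.restrict 𝔭) (π ⁅(x : 𝔤), (b i : 𝔤)⁆) (b j) = Q ⁅(x : 𝔤), (b i : 𝔤)⁆ (b j) :=
      hQ.proj_left hπ _ _
    rw [this, sq]
  have h2 := hQ.nonneg (kerPart π ⁅(x : 𝔤), (b i : 𝔤)⁆)
  rw [← h1]
  linarith

theorem central_of_killingForm_eq_zero (hQ : IsAdInvariantInner π Q) (hπ : IsReductive π)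
    (x : 𝔭) (hx : killingForm ℝ 𝔤 (x : 𝔤) (x : 𝔤) = 0) (z : 𝔤) : ⁅z, (x : 𝔤)⁆ = 0 := by
  obtain ⟨b, hb⟩ := exists_orthonormalFor (g := Q.restrict 𝔭) (fun x y => hQ.symm x y)
    (fun x hx => hQ.pos x (by simpa using hx))
  rw [killingForm_eq_neg_sum hQ hπ hb, neg_eq_zero, Finset.sum_eq_zero_iff_of_nonneg] at hx
  swap
  · intro i _
    have h1 := hQ.nonneg (kerPart π ⁅(x : 𝔤), (b i : 𝔤)⁆)
    have h2 := hQ.nonneg (π ⁅(x : 𝔤), (b i : 𝔤)⁆)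
    linarith
  have h0 : ∀ i, ⁅(x : 𝔤), (b i : 𝔤)⁆ = 0 := by
    intro i
    have h3 := hx i (Finset.mem_univ i)
    have h1 := hQ.nonneg (kerPart π ⁅(x : 𝔤), (b i : 𝔤)⁆)
    have h2 := hQ.nonneg (π ⁅(x : 𝔤), (b i : 𝔤)⁆)
    have h4 := hQ.eq_zero (x := kerPart π ⁅(x : 𝔤), (b i : 𝔤)⁆) (by linarith)
    have h5 := hQ.eq_zero (x := π ⁅(x : 𝔤), (b i : 𝔤)⁆) (by linarith)
    rw [kerPart_apply, h5, sub_zero] at h4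
    exact h4
  have h6 : ∀ y : 𝔭, ⁅(x : 𝔤), (y : 𝔤)⁆ = 0 := by
    intro y
    have h7 : LieAlgebra.ad ℝ 𝔤 (x : 𝔤) ∘ₗ 𝔭.subtype = 0 := b.ext fun i => h0 i
    exact LinearMap.congr_fun h7 y
  -- For `h ∈ ker π` the vector `[x, h]` lies in `𝔭`, hence commutes with `x`, and skewness gives
  -- `Q([x, h], [x, h]) = -Q(h, [x, [x, h]]) = 0`.
  have h8 : ⁅(x : 𝔤), kerPart π z⁆ = 0 := by
    apply hQ.eq_zero
    have h9 := hQ.skew x (kerPart π z) (π ⁅(x : 𝔤), kerPart π z⁆)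
    rw [h6, map_zero, add_zero, hπ.lie_kerPart] at h9
    exact h9
  have h10 : z = kerPart π z + π z := by rw [kerPart_apply, sub_add_cancel]
  rw [← lie_skew, h10, lie_add, h8, h6, add_zero, neg_zero]

variable {K : Type*} [Group K] {ρ : Representation ℝ K 𝔭} {g : LinearMap.BilinForm ℝ 𝔭}

namespace Decomposition

omit [FiniteDimensional ℝ 𝔤] in
-- Stationarity is used one summand at a time: this is the derivative in the scale of `P l` alone.
theorem diagGrad_single (D : Decomposition ρ g) (l : Fin D.q) :
    D.diagGrad π 0 (Pi.single l 1) = 1 / 2 * (D.killingValue l * D.d l)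
      - 1 / 4 * ∑ j, ∑ k, D.coeff π l j k + 1 / 2 * ∑ j, ∑ k, D.coeff π k l j := by
  have h1 : ∑ i, ∑ j, ∑ k, D.coeff π k i j *
      (Pi.single (M := fun _ => ℝ) l 1 k - Pi.single (M := fun _ => ℝ) l 1 i
        - Pi.single (M := fun _ => ℝ) l 1 j)
      = ∑ j, ∑ k, D.coeff π l j k - ∑ j, ∑ k, D.coeff π k l j - ∑ j, ∑ k, D.coeff π k j l := by
    simp only [mul_sub, Finset.sum_sub_distrib]
    congr 1
    · congr 1
      · simp [Pi.single_apply]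
      · rw [Finset.sum_eq_single l]
        · simp
        · intro i _ hi
          simp [hi]
        · simp
    · refine Finset.sum_congr rfl fun i _ => ?_
      rw [Finset.sum_eq_single l]
      · simp
      · intro i _ hi
        simp [hi]
      · simp
  have h2 : ∑ j, ∑ k, D.coeff π k j l = ∑ j, ∑ k, D.coeff π k l j := by
    simp only [D.coeff_comm _ l]
  simp only [diagGrad, Pi.zero_apply, neg_zero, sub_self, Real.exp_zero, mul_one]
  rw [h1, h2]
  simp [Pi.single_apply]
  ring

/-- If the scalar curvature is stationary in all directions, and `g` is a multiple of the
ad-invariant inner product on every summand, then every summand is central. -/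
theorem central_of_diagGrad_eq_zero (hQ : IsAdInvariantInner π Q) (hπ : IsReductive π)
    (hg : IsInvariantInner ρ g)
    (hkill : ∀ (k : K) (x y : 𝔭), killingForm ℝ 𝔤 (ρ k x : 𝔤) (ρ k y : 𝔤)
      = killingForm ℝ 𝔤 (x : 𝔤) (y : 𝔤))
    (D : Decomposition ρ g) {y : Fin D.q → ℝ}
    (hy : ∀ p r : Σ i, Fin (D.d i), Q (D.basis p) (D.basis r) = if p = r then y p.1 else 0)
    (hgrad : ∀ b, D.diagGrad π 0 b = 0) (x : 𝔭) (z : 𝔤) : ⁅z, (x : 𝔤)⁆ = 0 := by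
  have hypos : ∀ i, 0 < y i := by
    intro i
    have h := hy ⟨i, ⟨0, D.d_pos i⟩⟩ ⟨i, ⟨0, D.d_pos i⟩⟩
    rw [if_pos rfl] at h
    rw [← h]
    exact hQ.pos _ fun h0 => D.basis.ne_zero _ (Subtype.ext h0)
  have hu : ∀ p : Σ i, Fin (D.d i), IsUnit (Real.sqrt (y p.1))⁻¹ := fun p =>
    isUnit_iff_ne_zero.2 (inv_ne_zero (Real.sqrt_pos.2 (hypos p.1)).ne')
  -- On `P i` one has `Q = y i • g`, so dividing by the square root of `y i` gives a `Q`-orthonormal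
  -- basis, and `(y i)⁻¹` is the scale of `g` relative to `Q`.
  let u := D.basis.isUnitSMul hu
  have hu_apply : ∀ p, u p = (Real.sqrt (y p.1))⁻¹ • D.basis p := fun p => by
    simp only [u, Module.Basis.isUnitSMul_apply]
  have hsq : ∀ i, ((Real.sqrt (y i))⁻¹) ^ 2 = (y i)⁻¹ := fun i => by
    rw [inv_pow, Real.sq_sqrt (hypos i).le]
  have hub : OrthonormalFor (Q.restrict 𝔭) u := by
    intro p r
    have : (Q.restrict 𝔭) (u p) (u r) = (Real.sqrt (y r.1))⁻¹ * ((Real.sqrt (y p.1))⁻¹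
        * Q (D.basis p) (D.basis r)) := by
      rw [hu_apply, hu_apply, map_smul, map_smul]
      rfl
    rw [this, hy]
    split_ifs with h
    · subst h
      rw [← mul_assoc, ← sq, hsq, inv_mul_cancel₀ (hypos p.1).ne']
    · simp
  -- Measured with the ad-invariant `Q` the structure constants are totally antisymmetric, so the
  -- block sums `t` of their squares are totally symmetric; the scales of `g` appear only as
  -- explicit factors.
  let T : (Σ i, Fin (D.d i)) → (Σ i, Fin (D.d i)) → (Σ i, Fin (D.d i)) → ℝ :=
    fun p r s => Q ⁅(D.basis p : 𝔤), (D.basis r : 𝔤)⁆ (D.basis s)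
  have hT : ∀ p r s, structureConstant π g D.basis p r s = (y s.1)⁻¹ * T p r s := by
    intro p r s
    have h1 : T p r s = y s.1 * structureConstant π g D.basis p r s := by
      simp only [T]
      rw [← hQ.proj_left hπ, D.orthonormalFor_basis.eq_sum (π ⁅(D.basis p : 𝔤), (D.basis r : 𝔤)⁆)]
      simp only [Submodule.coe_sum, Submodule.coe_smul, map_sum, map_smul, LinearMap.sum_apply,
        LinearMap.smul_apply, hy, smul_eq_mul, mul_ite, mul_zero, Finset.sum_ite_eq',
        Finset.mem_univ, if_true]
      rw [mul_comm]
      rfl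
    rw [h1, inv_mul_cancel_left₀ (hypos s.1).ne']
  have hTswap : ∀ p r s, T p s r = - T p r s := by
    intro p r s
    have := hQ.skew (D.basis p : 𝔤) (D.basis r) (D.basis s)
    simp only [T]
    rw [hQ.symm (D.basis r : 𝔤)] at this
    linarith
  have hTcyc : ∀ p r s, T p r s = T s p r := by
    intro p r s
    rw [hTswap s r p]
    simp only [T]
    have := hQ.skew (D.basis r : 𝔤) (D.basis p) (D.basis s)
    rw [← lie_skew (D.basis p : 𝔤), map_neg, LinearMap.neg_apply,
      ← lie_skew (D.basis s : 𝔤), map_neg, LinearMap.neg_apply, hQ.symm ⁅(D.basis r : 𝔤), _⁆ (D.basis p)]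
    linarith
  let t : Fin D.q → Fin D.q → Fin D.q → ℝ := fun i j k =>
    ∑ α, ∑ β, ∑ γ, T ⟨i, α⟩ ⟨j, β⟩ ⟨k, γ⟩ ^ 2
  have ht0 : ∀ i j k, 0 ≤ t i j k := fun i j k => Finset.sum_nonneg fun _ _ =>
    Finset.sum_nonneg fun _ _ => Finset.sum_nonneg fun _ _ => sq_nonneg _
  have htswap : ∀ i j k, t i k j = t i j k := by
    intro i j k
    simp only [t]
    refine Finset.sum_congr rfl fun α _ => ?_
    rw [Finset.sum_comm]
    simp only [hTswap ⟨i, α⟩ ⟨j, _⟩ ⟨k, _⟩, neg_sq]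
  have htcyc : ∀ i j k, t i j k = t k i j := by
    intro i j k
    simp only [t]
    rw [← Fintype.sum_prod_type' (f := fun (α : Fin (D.d i)) (β : Fin (D.d j)) =>
      ∑ γ, T ⟨i, α⟩ ⟨j, β⟩ ⟨k, γ⟩ ^ 2), Finset.sum_comm]
    refine Finset.sum_congr rfl fun γ _ => ?_
    rw [Fintype.sum_prod_type]
    simp only [hTcyc ⟨i, _⟩]
  have hcoeff : ∀ k i j, D.coeff π k i j = ((y k)⁻¹) ^ 2 * t i j k := by
    intro k i j
    rw [coeff_eq]
    simp only [hT, mul_pow, t, Finset.mul_sum]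
  have hkl : ∀ l, ∑ j, ∑ k, (y j)⁻¹ * (y k)⁻¹ * t l j k ≤ -(D.killingValue l * D.d l) := by
    intro l
    have h1 : ∀ α : Fin (D.d l), ∑ j, ∑ k, (y j)⁻¹ * (y k)⁻¹ * ∑ β, ∑ γ,
        T ⟨l, α⟩ ⟨j, β⟩ ⟨k, γ⟩ ^ 2 ≤ - D.killingValue l := by
      intro α
      have h2 := sum_sq_le_neg_killingForm hQ hπ hub (D.basis ⟨l, α⟩)
      rw [basis_apply, D.killingForm_e hg hkill, ← basis_apply D ⟨l, α⟩] at h2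
      refine le_trans (le_of_eq ?_) h2
      simp only [Fintype.sum_sigma, Finset.mul_sum]
      refine Finset.sum_congr rfl fun j _ => ?_
      rw [Finset.sum_comm]
      refine Finset.sum_congr rfl fun β _ => Finset.sum_congr rfl fun k _ =>
        Finset.sum_congr rfl fun γ _ => ?_
      rw [hu_apply, hu_apply, ← hsq, ← hsq]
      simp only [Submodule.coe_smul, lie_smul, map_smul, LinearMap.smul_apply, smul_eq_mul, T]
      ring
    have h3 := Finset.sum_le_sum fun α (_ : α ∈ Finset.univ) => h1 α
    simp only [Finset.sum_const, Finset.card_univ, Fintype.card_fin, nsmul_eq_mul] at h3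
    refine le_trans (le_of_eq ?_) (h3.trans (le_of_eq (by ring)))
    rw [Finset.sum_comm (s := (Finset.univ : Finset (Fin (D.d l))))]
    refine Finset.sum_congr rfl fun j _ => ?_
    rw [Finset.sum_comm (s := (Finset.univ : Finset (Fin (D.d l))))]
    refine Finset.sum_congr rfl fun k _ => ?_
    rw [← Finset.mul_sum]
  -- This is `-4` times the stationarity equation, with the square completed. The first bracket is
  -- nonnegative by `hkl`, and the second sum is nonnegative when the scale of `P l` is maximal.
  have hid : ∀ l, 2 * (-(D.killingValue l * D.d l) - ∑ j, ∑ k, (y j)⁻¹ * (y k)⁻¹ * t l j k)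
      + ∑ j, ∑ k, (((y l)⁻¹) ^ 2 - ((y j)⁻¹ - (y k)⁻¹) ^ 2) * t l j k = 0 := by
    intro l
    have h1 := hgrad (Pi.single l 1)
    rw [diagGrad_single] at h1
    simp only [hcoeff] at h1
    have h2 : ∑ j, ∑ k, ((y l)⁻¹) ^ 2 * t j k l = ∑ j, ∑ k, ((y l)⁻¹) ^ 2 * t l j k := by
      exact Finset.sum_congr rfl fun j _ => Finset.sum_congr rfl fun k _ => by rw [htcyc j k l]
    have h3 : ∑ j, ∑ k, ((y k)⁻¹) ^ 2 * t l j k = ∑ j, ∑ k, ((y j)⁻¹) ^ 2 * t l j k := by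
      rw [Finset.sum_comm]
      exact Finset.sum_congr rfl fun k _ => Finset.sum_congr rfl fun j _ => by rw [htswap]
    have h4 : ∑ j, ∑ k, (((y l)⁻¹) ^ 2 - ((y j)⁻¹ - (y k)⁻¹) ^ 2) * t l j k
        = ∑ j, ∑ k, ((y l)⁻¹) ^ 2 * t l j k - ∑ j, ∑ k, ((y j)⁻¹) ^ 2 * t l j k
          - ∑ j, ∑ k, ((y k)⁻¹) ^ 2 * t l j k
          + 2 * ∑ j, ∑ k, (y j)⁻¹ * (y k)⁻¹ * t l j k := by
      simp only [Finset.mul_sum, ← Finset.sum_add_distrib, ← Finset.sum_sub_distrib]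
      exact Finset.sum_congr rfl fun j _ => Finset.sum_congr rfl fun k _ => by ring
    rw [h2] at h1
    linarith
  have hcentral : ∀ l, ∀ α : Fin (D.d l), ∀ w : 𝔤, ⁅w, (D.e l α : 𝔤)⁆ = 0 := by
    classical
    by_contra! hne
    -- Take a non-central summand of largest scale relative to `Q`. Central summands contribute
    -- nothing to `t`, so only scales at most that of `l` enter.
    obtain ⟨l, hl, hmax⟩ := Finset.exists_max_image
      (Finset.univ.filter fun l => ¬ ∀ α : Fin (D.d l), ∀ w : 𝔤, ⁅w, (D.e l α : 𝔤)⁆ = 0)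
      (fun l => (y l)⁻¹) (by
        obtain ⟨l, α, w, h⟩ := hne
        exact ⟨l, Finset.mem_filter.2 ⟨Finset.mem_univ _, fun h' => h (h' α w)⟩⟩)
    rw [Finset.mem_filter] at hl
    refine hl.2 ?_
    have htz : ∀ j k, (∀ α : Fin (D.d j), ∀ w : 𝔤, ⁅w, (D.e j α : 𝔤)⁆ = 0) → t l j k = 0 := by
      intro j k hj
      refine Finset.sum_eq_zero fun α _ => Finset.sum_eq_zero fun β _ =>
        Finset.sum_eq_zero fun γ _ => ?_
      simp only [T]
      rw [D.basis_apply ⟨j, β⟩, hj]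
      simp
    have hnonneg : ∀ j k, 0 ≤ (((y l)⁻¹) ^ 2 - ((y j)⁻¹ - (y k)⁻¹) ^ 2) * t l j k := by
      intro j k
      by_cases hj : ∀ α : Fin (D.d j), ∀ w : 𝔤, ⁅w, (D.e j α : 𝔤)⁆ = 0
      · rw [htz j k hj, mul_zero]
      by_cases hk : ∀ α : Fin (D.d k), ∀ w : 𝔤, ⁅w, (D.e k α : 𝔤)⁆ = 0
      · rw [← htswap, htz k j hk, mul_zero]
      have h1 := hmax j (Finset.mem_filter.2 ⟨Finset.mem_univ _, hj⟩)
      have h2 := hmax k (Finset.mem_filter.2 ⟨Finset.mem_univ _, hk⟩)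
      have h3 := inv_pos.2 (hypos j)
      have h4 := inv_pos.2 (hypos k)
      exact mul_nonneg (by nlinarith) (ht0 _ _ _)
    have hs := Finset.sum_nonneg fun j (_ : j ∈ Finset.univ) =>
      Finset.sum_nonneg fun k (_ : k ∈ Finset.univ) => hnonneg j k
    have h1 := hid l
    have h2 := hkl l
    have hs0 : ∑ j, ∑ k, (((y l)⁻¹) ^ 2 - ((y j)⁻¹ - (y k)⁻¹) ^ 2) * t l j k = 0 := by linarith
    -- Two positive numbers bounded by `(y l)⁻¹` differ by strictly less than `(y l)⁻¹`, so the
    -- coefficient of `t l j k` is positive whenever `j` and `k` are non-central.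
    have ht : ∀ j k, t l j k = 0 := by
      intro j k
      rw [Finset.sum_eq_zero_iff_of_nonneg fun j _ => Finset.sum_nonneg fun k _ => hnonneg j k]
        at hs0
      have h5 := hs0 j (Finset.mem_univ j)
      rw [Finset.sum_eq_zero_iff_of_nonneg fun k _ => hnonneg j k] at h5
      have h6 := h5 k (Finset.mem_univ k)
      by_cases hj : ∀ α : Fin (D.d j), ∀ w : 𝔤, ⁅w, (D.e j α : 𝔤)⁆ = 0
      · exact htz j k hj
      by_cases hk : ∀ α : Fin (D.d k), ∀ w : 𝔤, ⁅w, (D.e k α : 𝔤)⁆ = 0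
      · rw [← htswap, htz k j hk]
      have h7 := hmax j (Finset.mem_filter.2 ⟨Finset.mem_univ _, hj⟩)
      have h8 := hmax k (Finset.mem_filter.2 ⟨Finset.mem_univ _, hk⟩)
      have h3 := inv_pos.2 (hypos j)
      have h4 := inv_pos.2 (hypos k)
      refine (mul_eq_zero.1 h6).resolve_left (ne_of_gt ?_)
      nlinarith
    -- With all `t l j k` zero the identity `hid` reduces to the Killing term, and a vector of `𝔭`
    -- on which the Killing form vanishes is central.
    have hN : D.killingValue l * D.d l = 0 := by
      simp only [ht, mul_zero, Finset.sum_const_zero, sub_zero, add_zero] at h1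
      linarith
    have hkv : D.killingValue l = 0 :=
      (mul_eq_zero.1 hN).resolve_right (Nat.cast_ne_zero.2 (D.d_pos l).ne')
    intro α w
    exact central_of_killingForm_eq_zero hQ hπ _ (by rw [D.killingForm_e hg hkill, hkv]) w
  have h7 : LieAlgebra.ad ℝ 𝔤 z ∘ₗ 𝔭.subtype = 0 := D.basis.ext fun p => by
    rw [basis_apply]
    exact hcentral p.1 p.2 z
  exact LinearMap.congr_fun h7 x

end Decomposition

end Bochner

/-! ### The differential of the adjoint representation -/

section AdjointDerivative

open Filter Topology VectorField

variable (E : Type*) [NormedAddCommGroup E] [NormedSpace ℝ E]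
  (G : Type*) [TopologicalSpace G] [ChartedSpace E G] [Group G]

/-- The multiplication in the chart at the identity. -/
def chartMul (z : E × E) : E :=
  extChartAt 𝓘(ℝ, E) (1 : G)
    ((extChartAt 𝓘(ℝ, E) (1 : G)).symm z.1 * (extChartAt 𝓘(ℝ, E) (1 : G)).symm z.2)

/-- The identity in the chart at the identity. -/
def chartOne : E := extChartAt 𝓘(ℝ, E) (1 : G) 1

theorem chart_symm_chartOne : (extChartAt 𝓘(ℝ, E) (1 : G)).symm (chartOne E G) = 1 :=
  extChartAt_to_inv (I := 𝓘(ℝ, E)) (1 : G)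

theorem chart_target_mem_nhds : (extChartAt 𝓘(ℝ, E) (1 : G)).target ∈ 𝓝 (chartOne E G) :=
  extChartAt_target_mem_nhds (I := 𝓘(ℝ, E)) (1 : G)

/-- The tangent space at the identity is identified with `E` by this very chart, so its derivative
there is the identity. -/
theorem hasMFDerivAt_chart :
    HasMFDerivAt 𝓘(ℝ, E) 𝓘(ℝ, E) (extChartAt 𝓘(ℝ, E) (1 : G)) (1 : G)
      (ContinuousLinearMap.id ℝ E) := by
  refine ⟨continuousAt_extChartAt (I := 𝓘(ℝ, E)) (1 : G), ?_⟩
  show HasFDerivWithinAt _ (ContinuousLinearMap.id ℝ E) _ (chartOne E G)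
  refine HasFDerivAt.hasFDerivWithinAt
    ((hasFDerivAt_id (𝕜 := ℝ) (chartOne E G)).congr_of_eventuallyEq ?_)
  filter_upwards [chart_target_mem_nhds E G] with x hx
  exact (extChartAt 𝓘(ℝ, E) (1 : G)).right_inv hx

theorem hasMFDerivAt_chart_symm :
    HasMFDerivAt 𝓘(ℝ, E) 𝓘(ℝ, E) (extChartAt 𝓘(ℝ, E) (1 : G)).symm (chartOne E G)
      (ContinuousLinearMap.id ℝ E) := by
  refine ⟨?_, ?_⟩
  · exact continuousAt_extChartAt_symm (I := 𝓘(ℝ, E)) (1 : G)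
  show HasFDerivWithinAt _ (ContinuousLinearMap.id ℝ E) _ (chartOne E G)
  refine HasFDerivAt.hasFDerivWithinAt
    ((hasFDerivAt_id (𝕜 := ℝ) (chartOne E G)).congr_of_eventuallyEq ?_)
  filter_upwards [chart_target_mem_nhds E G] with x hx
  unfold writtenInExtChartAt
  rw [chart_symm_chartOne]
  exact (extChartAt 𝓘(ℝ, E) (1 : G)).right_inv hx

variable [LieGroup 𝓘(ℝ, E) ∞ G]

theorem contDiffAt_chartMul : ContDiffAt ℝ ∞ (chartMul E G) (chartOne E G, chartOne E G) := by
  have h1 : ∀ f : E × E → E, ContDiff ℝ ∞ f → f (chartOne E G, chartOne E G) = chartOne E G →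
      ContMDiffAt 𝓘(ℝ, E × E) 𝓘(ℝ, E) ∞ (fun z => (extChartAt 𝓘(ℝ, E) (1 : G)).symm (f z))
        (chartOne E G, chartOne E G) := by
    intro f hf hf0
    have h := contMDiffOn_extChartAt_symm (I := 𝓘(ℝ, E)) (n := ∞) (1 : G)
    have h' : ContMDiffAt 𝓘(ℝ, E) 𝓘(ℝ, E) ∞ (extChartAt 𝓘(ℝ, E) (1 : G)).symm
        (f (chartOne E G, chartOne E G)) := by
      rw [hf0]; exact h.contMDiffAt (chart_target_mem_nhds E G)
    exact h'.comp _ hf.contMDiff.contMDiffAt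
  have h2 := (h1 Prod.fst contDiff_fst rfl).mul (h1 Prod.snd contDiff_snd rfl)
  rw [← contMDiffAt_iff_contDiffAt]
  refine ContMDiffAt.comp (I' := 𝓘(ℝ, E)) (g := extChartAt 𝓘(ℝ, E) (1 : G)) _ ?_ h2
  simp only [chart_symm_chartOne, mul_one]
  exact contMDiffAt_extChartAt

theorem eventually_contDiffAt_chartMul :
    ∀ᶠ z in 𝓝 (chartOne E G, chartOne E G), DifferentiableAt ℝ (chartMul E G) z := by
  have := ((contDiffAt_chartMul E G).of_le (m := 2) ENat.LEInfty.out).eventually (by simp)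
  exact this.mono fun z hz => hz.differentiableAt (by simp)

theorem eventually_chart :
    ∀ᶠ x in 𝓝 (chartOne E G), x ∈ (extChartAt 𝓘(ℝ, E) (1 : G)).target ∧
      DifferentiableAt ℝ (chartMul E G) (x, chartOne E G) ∧
      DifferentiableAt ℝ (chartMul E G) (chartOne E G, x) := by
  have h1 : Tendsto (fun x => (x, chartOne E G)) (𝓝 (chartOne E G))
      (𝓝 (chartOne E G, chartOne E G)) := (Continuous.prodMk_left _).tendsto _
  have h2 : Tendsto (fun x => (chartOne E G, x)) (𝓝 (chartOne E G))
      (𝓝 (chartOne E G, chartOne E G)) := (Continuous.prodMk_right _).tendsto _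
  filter_upwards [chart_target_mem_nhds E G, h1.eventually (eventually_contDiffAt_chartMul E G),
    h2.eventually (eventually_contDiffAt_chartMul E G)] with x hx hy hz
  exact ⟨hx, hy, hz⟩

variable {E G}

omit [LieGroup 𝓘(ℝ, E) ∞ G] in
/-- A map out of the group and its expression in the chart at the identity have the same
derivative. -/
theorem hasMFDerivAt_of_hasFDerivAt_comp_chart_symm {F : Type*} [NormedAddCommGroup F]
    [NormedSpace ℝ F] {f : G → F} {L : E →L[ℝ] F}
    (h : HasFDerivAt (fun x => f ((extChartAt 𝓘(ℝ, E) (1 : G)).symm x)) L (chartOne E G)) :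
    HasMFDerivAt 𝓘(ℝ, E) 𝓘(ℝ, F) f (1 : G) L := by
  have h1 := HasMFDerivAt.comp (1 : G) (f := extChartAt 𝓘(ℝ, E) (1 : G)) h.hasMFDerivAt
    (hasMFDerivAt_chart E G)
  refine HasMFDerivAt.congr_of_eventuallyEq (f' := L) h1 ?_
  filter_upwards [extChartAt_source_mem_nhds (I := 𝓘(ℝ, E)) (1 : G)] with y hy
  exact congrArg f ((extChartAt 𝓘(ℝ, E) (1 : G)).left_inv hy).symm

omit [LieGroup 𝓘(ℝ, E) ∞ G] in
theorem hasMFDerivAt_chart_mul_left {x : E}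
    (hd : DifferentiableAt ℝ (chartMul E G) (x, chartOne E G)) :
    HasMFDerivAt 𝓘(ℝ, E) 𝓘(ℝ, E) (fun y : G => extChartAt 𝓘(ℝ, E) (1 : G)
      ((extChartAt 𝓘(ℝ, E) (1 : G)).symm x * y)) 1
      (fderiv ℝ (chartMul E G) (x, chartOne E G) ∘L ContinuousLinearMap.inr ℝ E E) :=
  hasMFDerivAt_of_hasFDerivAt_comp_chart_symm
    (hd.hasFDerivAt.comp (chartOne E G) (hasFDerivAt_prodMk_right x (chartOne E G)))

omit [LieGroup 𝓘(ℝ, E) ∞ G] in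
theorem hasMFDerivAt_chart_mul_right {x : E}
    (hd : DifferentiableAt ℝ (chartMul E G) (chartOne E G, x)) :
    HasMFDerivAt 𝓘(ℝ, E) 𝓘(ℝ, E) (fun y : G => extChartAt 𝓘(ℝ, E) (1 : G)
      (y * (extChartAt 𝓘(ℝ, E) (1 : G)).symm x)) 1
      (fderiv ℝ (chartMul E G) (chartOne E G, x) ∘L ContinuousLinearMap.inl ℝ E E) :=
  hasMFDerivAt_of_hasFDerivAt_comp_chart_symm
    (HasFDerivAt.comp (g := chartMul E G) (chartOne E G) hd.hasFDerivAt
      (hasFDerivAt_prodMk_left (𝕜 := ℝ) (chartOne E G) x))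

/-- The right-invariant field of `Ad(x) Y` and the left-invariant field of `Y` agree at `x`. -/
theorem fderiv_chartMul_Ad {x : E} (hd : DifferentiableAt ℝ (chartMul E G) (x, chartOne E G))
    (hd' : DifferentiableAt ℝ (chartMul E G) (chartOne E G, x)) (Y : E) :
    fderiv ℝ (chartMul E G) (chartOne E G, x)
        ((Ad E ((extChartAt 𝓘(ℝ, E) (1 : G)).symm x) Y : E), 0)
      = fderiv ℝ (chartMul E G) (x, chartOne E G) (0, Y) := by
  set a := (extChartAt 𝓘(ℝ, E) (1 : G)).symm x with ha
  have h1 := hasMFDerivAt_chart_mul_left hd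
  -- Stated for any `z` equal to `1` because the chain rule needs it at `a * 1 * a⁻¹`, where the
  -- tangent space depends on the expression for the point.
  have h2 : ∀ z : G, z = 1 → HasMFDerivAt 𝓘(ℝ, E) 𝓘(ℝ, E)
      (fun y : G => extChartAt 𝓘(ℝ, E) (1 : G) (y * (extChartAt 𝓘(ℝ, E) (1 : G)).symm x)) z
      (fderiv ℝ (chartMul E G) (chartOne E G, x) ∘L ContinuousLinearMap.inl ℝ E E) := by
    rintro z rfl
    exact hasMFDerivAt_chart_mul_right hd'
  have h3 := HasMFDerivAt.comp (1 : G) (h2 (a * 1 * a⁻¹) (by simp)) (hasMFDerivAt_conj E a 1 rfl)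
  have h4 : (fun y : G => extChartAt 𝓘(ℝ, E) (1 : G) (y * (extChartAt 𝓘(ℝ, E) (1 : G)).symm x))
      ∘ (fun y : G => a * y * a⁻¹) = fun y : G => extChartAt 𝓘(ℝ, E) (1 : G) (a * y) := by
    funext y
    simp only [Function.comp_apply, ← ha, inv_mul_cancel_right]
  rw [h4] at h3
  have h5 := DFunLike.congr_fun (hasMFDerivAt_unique h3 h1) Y
  exact h5

/-- Left-invariant fields in the chart at the identity. -/
theorem mpullbackWithin_chart_symm_mulInvariantVectorField {x : E}
    (hx : x ∈ (extChartAt 𝓘(ℝ, E) (1 : G)).target)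
    (hd : DifferentiableAt ℝ (chartMul E G) (x, chartOne E G)) (X : GroupLieAlgebra 𝓘(ℝ, E) G) :
    (mpullbackWithin 𝓘(ℝ, E) 𝓘(ℝ, E) (extChartAt 𝓘(ℝ, E) (1 : G)).symm
      (mulInvariantVectorField X) (Set.range 𝓘(ℝ, E)) x : E)
      = fderiv ℝ (chartMul E G) (x, chartOne E G) (0, (X : E)) := by
  have h1 := mfderiv_extChartAt_comp_mfderivWithin_extChartAt_symm (I := 𝓘(ℝ, E)) hx
  have h2 := mfderivWithin_extChartAt_symm_comp_mfderiv_extChartAt (I := 𝓘(ℝ, E)) hx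
  rw [mpullbackWithin_apply, ContinuousLinearMap.inverse_eq h2 h1, mulInvariantVectorField]
  have h3 := hasMFDerivAt_chart_mul_left hd
  set a := (extChartAt 𝓘(ℝ, E) (1 : G)).symm x with ha
  have ha' : a ∈ (chartAt E (1 : G)).source := by
    rw [← extChartAt_source 𝓘(ℝ, E)]
    exact (extChartAt 𝓘(ℝ, E) (1 : G)).map_target hx
  have h4 : ∀ z : G, z = a → HasMFDerivAt 𝓘(ℝ, E) 𝓘(ℝ, E) (extChartAt 𝓘(ℝ, E) (1 : G)) z
      (mfderiv 𝓘(ℝ, E) 𝓘(ℝ, E) (extChartAt 𝓘(ℝ, E) (1 : G)) a) := by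
    rintro z rfl
    exact (mdifferentiableAt_extChartAt ha').hasMFDerivAt
  have h5 : MDifferentiableAt 𝓘(ℝ, E) 𝓘(ℝ, E) (fun y : G => a * y) 1 :=
    (contMDiff_mul_left (I := 𝓘(ℝ, E)) (n := ∞) (a := a)).mdifferentiable (by simp) _
  have h6 := HasMFDerivAt.comp (1 : G) (h4 (a * 1) (mul_one a)) h5.hasMFDerivAt
  exact DFunLike.congr_fun (hasMFDerivAt_unique h6 h3) X

variable (E G) in
/-- The mixed second derivative of the multiplication. -/
def chartMulSecond : E × E →L[ℝ] E × E →L[ℝ] E :=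
  fderiv ℝ (fderiv ℝ (chartMul E G)) (chartOne E G, chartOne E G)

variable (E G) in
theorem hasFDerivAt_fderiv_chartMul :
    HasFDerivAt (fderiv ℝ (chartMul E G)) (chartMulSecond E G) (chartOne E G, chartOne E G) :=
  ((((contDiffAt_chartMul E G).of_le (m := 2) ENat.LEInfty.out).fderiv_right (m := 1)
    one_add_one_eq_two.le).differentiableAt (by simp)).hasFDerivAt

theorem hasFDerivAt_leftField (Y : E) :
    HasFDerivAt (fun x => fderiv ℝ (chartMul E G) (x, chartOne E G) (0, Y))
      ((ContinuousLinearMap.apply ℝ E ((0 : E), Y)) ∘L chartMulSecond E G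
        ∘L ContinuousLinearMap.inl ℝ E E) (chartOne E G) :=
  (ContinuousLinearMap.apply ℝ E ((0 : E), Y)).hasFDerivAt.comp (chartOne E G)
    (HasFDerivAt.comp (g := fderiv ℝ (chartMul E G)) (chartOne E G)
      (hasFDerivAt_fderiv_chartMul E G) (hasFDerivAt_prodMk_left (𝕜 := ℝ) (chartOne E G)
        (chartOne E G)))

variable (E G) in
/-- The derivative of the right multiplications at the identity, in the chart. -/
def rightField (x : E) : E →L[ℝ] E :=
  fderiv ℝ (chartMul E G) (chartOne E G, x) ∘L ContinuousLinearMap.inl ℝ E E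

variable (E G) in
theorem hasFDerivAt_rightField :
    HasFDerivAt (rightField E G)
      ((ContinuousLinearMap.compL ℝ E (E × E) E).flip (ContinuousLinearMap.inl ℝ E E)
        ∘L chartMulSecond E G ∘L ContinuousLinearMap.inr ℝ E E) (chartOne E G) :=
  ((ContinuousLinearMap.compL ℝ E (E × E) E).flip
    (ContinuousLinearMap.inl ℝ E E)).hasFDerivAt.comp (chartOne E G)
    (HasFDerivAt.comp (g := fderiv ℝ (chartMul E G)) (chartOne E G)
      (hasFDerivAt_fderiv_chartMul E G) (hasFDerivAt_prodMk_right (𝕜 := ℝ) (chartOne E G)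
        (chartOne E G)))

theorem fderiv_chartMul_chartOne_right (Y : E) :
    fderiv ℝ (chartMul E G) (chartOne E G, chartOne E G) (0, Y) = Y := by
  have h1 := hasMFDerivAt_chart_mul_left (eventually_contDiffAt_chartMul E G).self_of_nhds
  have e : (fun y : G => extChartAt 𝓘(ℝ, E) (1 : G)
      ((extChartAt 𝓘(ℝ, E) (1 : G)).symm (chartOne E G) * y)) = extChartAt 𝓘(ℝ, E) (1 : G) := by
    funext y
    rw [chart_symm_chartOne, one_mul]
  rw [e] at h1
  exact DFunLike.congr_fun (hasMFDerivAt_unique h1 (hasMFDerivAt_chart E G)) Y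

theorem rightField_chartOne : rightField E G (chartOne E G) = 1 := by
  have h1 := hasMFDerivAt_chart_mul_right (eventually_contDiffAt_chartMul E G).self_of_nhds
  have e : (fun y : G => extChartAt 𝓘(ℝ, E) (1 : G)
      (y * (extChartAt 𝓘(ℝ, E) (1 : G)).symm (chartOne E G))) = extChartAt 𝓘(ℝ, E) (1 : G) := by
    funext y
    rw [chart_symm_chartOne, mul_one]
  rw [e] at h1
  exact hasMFDerivAt_unique h1 (hasMFDerivAt_chart E G)

variable (G) in
/-- The Lie bracket, with the Lie algebra regarded as the model space. -/
def modelLie (X Y : E) : E :=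
  Bracket.bracket (L := GroupLieAlgebra 𝓘(ℝ, E) G) (M := GroupLieAlgebra 𝓘(ℝ, E) G) X Y

/-- The Lie bracket in terms of the multiplication in the chart at the identity. -/
theorem modelLie_eq (X Y : E) :
    modelLie G X Y = chartMulSecond E G (X, 0) (0, Y) - chartMulSecond E G (Y, 0) (0, X) := by
  have hL : ∀ Z : GroupLieAlgebra 𝓘(ℝ, E) G,
      (mpullbackWithin 𝓘(ℝ, E) 𝓘(ℝ, E) (extChartAt 𝓘(ℝ, E) (1 : G)).symm
        (mulInvariantVectorField Z) (Set.range 𝓘(ℝ, E)) : E → E)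
      =ᶠ[𝓝 (chartOne E G)] fun x => fderiv ℝ (chartMul E G) (x, chartOne E G) (0, (Z : E)) := by
    intro Z
    filter_upwards [eventually_chart E G] with x hx
    exact mpullbackWithin_chart_symm_mulInvariantVectorField hx.1 hx.2.1 Z
  -- The bracket of fields on the group is the chart bracket pulled back by the chart; at the
  -- identity this pullback does nothing.
  have h1 : ∀ Z : E, (mfderiv 𝓘(ℝ, E) 𝓘(ℝ, E) (extChartAt 𝓘(ℝ, E) (1 : G)) 1).inverse Z = Z := by
    intro Z
    have h2 : ∀ L : E →L[ℝ] E, L = ContinuousLinearMap.id ℝ E → L.inverse Z = Z := by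
      rintro _ rfl
      simp
    exact h2 _ (hasMFDerivAt_chart E G).mfderiv
  have key : ∀ V W : E → E,
      V =ᶠ[𝓝 (chartOne E G)] (fun x => fderiv ℝ (chartMul E G) (x, chartOne E G) (0, X)) →
      W =ᶠ[𝓝 (chartOne E G)] (fun x => fderiv ℝ (chartMul E G) (x, chartOne E G) (0, Y)) →
      lieBracketWithin ℝ V W ((extChartAt 𝓘(ℝ, E) (1 : G)).symm ⁻¹' Set.univ ∩ Set.range 𝓘(ℝ, E))
        (chartOne E G) = chartMulSecond E G (X, 0) (0, Y)
          - chartMulSecond E G (Y, 0) (0, X) := by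
    intro V W hV hW
    rw [Set.preimage_univ, Set.univ_inter, modelWithCornersSelf_coe, Set.range_id,
      lieBracketWithin_univ, Filter.EventuallyEq.lieBracket_vectorField_eq hV hW,
      lieBracket, (hasFDerivAt_leftField (G := G) X).fderiv,
      (hasFDerivAt_leftField (G := G) Y).fderiv, fderiv_chartMul_chartOne_right,
      fderiv_chartMul_chartOne_right]
    rfl
  exact (h1 _).trans (key _ _ (hL X) (hL Y))

variable [CompleteSpace E]

variable (G) in
/-- The orbit map `a ↦ Ad(a) Y`, with values in the model space. -/
def adOrbit (Y : E) (a : G) : E := Ad E a Y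

/-- In the chart, `Ad(x) Y` is the inverse of the right-translation derivative applied to the
left-invariant field of `Y`. Both factors are differentiable and the first is the identity at the
base point, so the product rule yields a difference of two mixed second derivatives of the
multiplication. -/
theorem hasMFDerivAt_Ad_model (Y : E) :
    ∃ L : E →L[ℝ] E, (∀ X, L X = modelLie G X Y) ∧
      HasMFDerivAt 𝓘(ℝ, E) 𝓘(ℝ, E) (adOrbit G Y) 1 L := by
  have hinv := hasFDerivAt_ringInverse (𝕜 := ℝ) (1 : (E →L[ℝ] E)ˣ)
  have h1 : HasFDerivAt (fun x => Ring.inverse (rightField E G x)) _ (chartOne E G) :=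
    HasFDerivAt.comp (g := Ring.inverse) (chartOne E G)
      (by rw [rightField_chartOne]; exact hinv) (hasFDerivAt_rightField E G)
  have h2 := h1.clm_apply (hasFDerivAt_leftField (G := G) Y)
  have h3 : (fun x => adOrbit G Y ((extChartAt 𝓘(ℝ, E) (1 : G)).symm x))
      =ᶠ[𝓝 (chartOne E G)] fun x => Ring.inverse (rightField E G x)
        (fderiv ℝ (chartMul E G) (x, chartOne E G) (0, Y)) := by
    have hu : ∀ᶠ x in 𝓝 (chartOne E G), IsUnit (rightField E G x) := by
      have hc := (hasFDerivAt_rightField E G).continuousAt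
      refine hc.eventually (Units.isOpen.mem_nhds ?_)
      rw [rightField_chartOne]
      exact isUnit_one
    filter_upwards [eventually_chart E G, hu] with x hx hu
    rw [← fderiv_chartMul_Ad hx.2.1 hx.2.2]
    have h4 := DFunLike.congr_fun (Ring.inverse_mul_cancel _ hu)
      (Ad E ((extChartAt 𝓘(ℝ, E) (1 : G)).symm x) Y : E)
    exact h4.symm
  refine ⟨_, fun X => ?_,
    hasMFDerivAt_of_hasFDerivAt_comp_chart_symm (h2.congr_of_eventuallyEq h3)⟩
  -- Differentiating the inverse produces the derivative `(0, X)` against `(Y, 0)`; symmetry puts it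
  -- in the order occurring in `modelLie_eq`.
  have hsymm : ∀ u w, chartMulSecond E G u w = chartMulSecond E G w u := by
    have := ((contDiffAt_chartMul E G).isSymmSndFDerivAt
      (by rw [minSmoothness_of_isRCLikeNormedField]; exact ENat.LEInfty.out))
    exact fun u w => this.eq u w
  rw [modelLie_eq, hsymm (Y, 0) (0, X)]
  simp [rightField_chartOne, fderiv_chartMul_chartOne_right]
  abel

/-- The differential of `a ↦ Ad(a) Y` at the identity is `X ↦ [X, Y]`. -/
theorem hasDerivAt_adOrbit {γ : ℝ → G} {X : E}
    (hγ : HasMFDerivAt 𝓘(ℝ, ℝ) 𝓘(ℝ, E) γ 0 (ContinuousLinearMap.toSpanSingleton ℝ X : ℝ →L[ℝ] E))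
    (h0 : γ 0 = 1) (Y : E) :
    HasDerivAt (fun t => adOrbit G Y (γ t)) (modelLie G X Y) 0 := by
  obtain ⟨L, hL, hd⟩ := hasMFDerivAt_Ad_model (G := G) Y
  have h1 : HasMFDerivAt 𝓘(ℝ, E) 𝓘(ℝ, E) (adOrbit G Y) (γ 0) L := by rw [h0]; exact hd
  have h2 : HasFDerivAt (fun t => adOrbit G Y (γ t))
      (L ∘L (ContinuousLinearMap.toSpanSingleton ℝ X : ℝ →L[ℝ] E)) 0 :=
    (HasMFDerivAt.comp (0 : ℝ) h1 hγ).hasFDerivAt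
  have h3 := h2.hasDerivAt
  simpa [hL] using h3

omit [CompleteSpace E] in
omit [LieGroup 𝓘(ℝ, E) ∞ G] in
-- A straight line in the chart. It may leave the chart's target, but only its derivative at `0`
-- matters.
theorem exists_curve (X : E) : ∃ γ : ℝ → G, γ 0 = 1 ∧
    HasMFDerivAt 𝓘(ℝ, ℝ) 𝓘(ℝ, E) γ 0 (ContinuousLinearMap.toSpanSingleton ℝ X : ℝ →L[ℝ] E) := by
  refine ⟨fun t => (extChartAt 𝓘(ℝ, E) (1 : G)).symm (chartOne E G + t • X),
    by simp only [zero_smul, add_zero, chart_symm_chartOne], ?_⟩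
  have h1 : ∀ y : E, y = chartOne E G → HasMFDerivAt 𝓘(ℝ, E) 𝓘(ℝ, E)
      (extChartAt 𝓘(ℝ, E) (1 : G)).symm y (ContinuousLinearMap.id ℝ E) := by
    rintro y rfl
    exact hasMFDerivAt_chart_symm E G
  have h2 : HasFDerivAt (fun t : ℝ => chartOne E G + t • X)
      (ContinuousLinearMap.toSpanSingleton ℝ X) 0 :=
    (ContinuousLinearMap.toSpanSingleton ℝ X).hasFDerivAt.const_add (chartOne E G)
  exact HasMFDerivAt.comp (0 : ℝ) (h1 (chartOne E G + (0 : ℝ) • X) (by simp)) h2.hasMFDerivAt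

omit [CompleteSpace E] in
theorem adOrbit_mul (Y : E) (a b : G) : adOrbit G Y (a * b) = adOrbit G (adOrbit G Y b) a := by
  unfold adOrbit
  rw [Ad_mul]
  rfl

/-- `Ad(a)` is a homomorphism of Lie algebras. -/
theorem adOrbit_modelLie (a : G) (X Y : E) :
    adOrbit G (modelLie G X Y) a = modelLie G (adOrbit G X a) (adOrbit G Y a) := by
  obtain ⟨L, hL, hd⟩ := hasMFDerivAt_Ad_model (G := G) Y
  obtain ⟨L', hL', hd'⟩ := hasMFDerivAt_Ad_model (G := G) (adOrbit G Y a)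
  have h1 : ∀ z : G, z = 1 →
      HasMFDerivAt 𝓘(ℝ, E) 𝓘(ℝ, E) (adOrbit G (adOrbit G Y a)) z L' := by
    rintro z rfl; exact hd'
  have h2 := HasMFDerivAt.comp (1 : G) (h1 (a * 1 * a⁻¹) (by simp)) (hasMFDerivAt_conj E a 1 rfl)
  let A : E →L[ℝ] E := mfderiv 𝓘(ℝ, E) 𝓘(ℝ, E) (fun x : G => a * x * a⁻¹) 1
  have h3 := HasMFDerivAt.comp (1 : G) (A.hasFDerivAt (x := adOrbit G Y 1)).hasMFDerivAt hd
  have h4 : adOrbit G (adOrbit G Y a) ∘ (fun x : G => a * x * a⁻¹) = A ∘ adOrbit G Y := by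
    -- Both sides are `b ↦ Ad(a) Ad(b) Y`. Differentiating the two factorisations at the identity
    -- gives `Ad(a)[X, Y] = [Ad(a) X, Ad(a) Y]`.
    funext b
    show adOrbit G (adOrbit G Y a) (a * b * a⁻¹) = adOrbit G (adOrbit G Y b) a
    rw [← adOrbit_mul, ← adOrbit_mul, inv_mul_cancel_right]
  rw [h4] at h2
  have h5 := DFunLike.congr_fun (hasMFDerivAt_unique h3 h2) X
  have h6 : A (L X) = L' (A X) := h5
  rw [hL, hL'] at h6
  exact h6

omit [Group G] [LieGroup 𝓘(ℝ, E) ∞ G] [CompleteSpace E] in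
-- Read in a chart on a ball, which is connected, `f` has zero derivative and is therefore constant.
theorem isLocallyConstant_of_hasMFDerivAt_zero [IsManifold 𝓘(ℝ, E) ∞ G] {f : G → E}
    (h : ∀ b : G, HasMFDerivAt 𝓘(ℝ, E) 𝓘(ℝ, E) f b (0 : E →L[ℝ] E)) : IsLocallyConstant f := by
  rw [IsLocallyConstant.iff_eventually_eq]
  intro b
  have hU := extChartAt_target_mem_nhds (I := 𝓘(ℝ, E)) b
  obtain ⟨r, hr, hball⟩ := Metric.mem_nhds_iff.1 hU
  have hF : ∀ x ∈ (extChartAt 𝓘(ℝ, E) b).target,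
      HasFDerivAt (fun x => f ((extChartAt 𝓘(ℝ, E) b).symm x)) (0 : E →L[ℝ] E) x := by
    intro x hx
    have h1 := mdifferentiableWithinAt_extChartAt_symm (I := 𝓘(ℝ, E)) hx
    rw [modelWithCornersSelf_coe, Set.range_id, mdifferentiableWithinAt_univ] at h1
    have h2 := (HasMFDerivAt.comp x (h _) h1.hasMFDerivAt).hasFDerivAt
    refine h2.congr_fderiv ?_
    have e6 : ∀ D : E →L[ℝ] E, (0 : E →L[ℝ] E) ∘L D = 0 := fun D => by ext; simp
    exact e6 _
  have hconst : ∀ x ∈ Metric.ball (extChartAt 𝓘(ℝ, E) b b) r,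
      f ((extChartAt 𝓘(ℝ, E) b).symm x) = f b := by
    intro x hx
    have h3 := Metric.isOpen_ball.is_const_of_fderiv_eq_zero (𝕜 := ℝ)
      (convex_ball (extChartAt 𝓘(ℝ, E) b b) r).isPreconnected
      (fun y hy => (hF y (hball hy)).differentiableAt.differentiableWithinAt)
      (fun y hy => (hF y (hball hy)).fderiv) hx (Metric.mem_ball_self hr)
    rw [extChartAt_to_inv] at h3
    exact h3
  have hc : ContinuousAt (extChartAt 𝓘(ℝ, E) b) b := continuousAt_extChartAt b
  filter_upwards [hc.eventually (Metric.ball_mem_nhds _ hr),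
    extChartAt_source_mem_nhds (I := 𝓘(ℝ, E)) b] with c hc1 hc2
  rw [← hconst _ hc1, (extChartAt 𝓘(ℝ, E) b).left_inv hc2]

/-- A central element of the Lie algebra of a connected group is fixed by the adjoint
representation. -/
theorem adOrbit_eq_of_central [ConnectedSpace G] {Y : E} (hY : ∀ X, modelLie G X Y = 0) (a : G) :
    adOrbit G Y a = Y := by
  have h1 : adOrbit G Y 1 = Y := by unfold adOrbit; rw [Ad_one]; rfl
  obtain ⟨L, hL, hd⟩ := hasMFDerivAt_Ad_model (G := G) Y
  have hL0 : L = 0 := by ext X; simp [hL, hY]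
  subst hL0
  -- The vanishing derivative at the identity is carried to `b` by left translation, since `Ad(c) Y
  -- = Ad(b) Ad(b⁻¹ c) Y`.
  have hzero : ∀ b : G, HasMFDerivAt 𝓘(ℝ, E) 𝓘(ℝ, E) (adOrbit G Y) b (0 : E →L[ℝ] E) := by
    intro b
    have e1 : ∀ z : G, z = 1 → HasMFDerivAt 𝓘(ℝ, E) 𝓘(ℝ, E) (adOrbit G Y) z (0 : E →L[ℝ] E) := by
      rintro z rfl; exact hd
    have e2 : MDifferentiableAt 𝓘(ℝ, E) 𝓘(ℝ, E) (fun y : G => b⁻¹ * y) b :=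
      (contMDiff_mul_left (I := 𝓘(ℝ, E)) (n := ∞) (a := b⁻¹)).mdifferentiable (by simp) _
    have e3 := HasMFDerivAt.comp b (e1 (b⁻¹ * b) (by simp)) e2.hasMFDerivAt
    let A : E →L[ℝ] E := mfderiv 𝓘(ℝ, E) 𝓘(ℝ, E) (fun x : G => b * x * b⁻¹) 1
    have e4 := HasMFDerivAt.comp b (A.hasFDerivAt (x := adOrbit G Y (b⁻¹ * b))).hasMFDerivAt e3
    have e5 : A ∘ adOrbit G Y ∘ (fun y : G => b⁻¹ * y) = adOrbit G Y := by
      funext c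
      show adOrbit G (adOrbit G Y (b⁻¹ * c)) b = adOrbit G Y c
      rw [← adOrbit_mul, mul_inv_cancel_left]
    rw [e5] at e4
    exact e4.congr_mfderiv (by
      have e6 : ∀ D : E →L[ℝ] E, A ∘L ((0 : E →L[ℝ] E) ∘L D) = 0 := fun D => by ext; simp
      exact e6 _)
  rw [(isLocallyConstant_of_hasMFDerivAt_zero hzero).apply_eq_of_preconnectedSpace a 1, h1]

end AdjointDerivative

/-! ### The reductive structure of the Lie algebra -/

section LieGroupReductive

variable {E : Type*} [NormedAddCommGroup E] [NormedSpace ℝ E] [FiniteDimensional ℝ E]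
  {G : Type*} [TopologicalSpace G] [ChartedSpace E G] [Group G]

theorem hasDerivAt_bilinear (β : E →ₗ[ℝ] E →ₗ[ℝ] ℝ) {u w : ℝ → E} {u' w' : E}
    (hu : HasDerivAt u u' 0) (hw : HasDerivAt w w' 0) :
    HasDerivAt (fun t => β (u t) (w t)) (β u' (w 0) + β (u 0) w') 0 := by
  let B : E →L[ℝ] E →L[ℝ] ℝ := LinearMap.toContinuousLinearMap
    ((LinearMap.toContinuousLinearMap (E := E) (F' := ℝ) (𝕜 := ℝ)).toLinearMap ∘ₗ β)
  exact (B.hasFDerivAt.comp_hasDerivAt 0 hu).clm_apply hw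

omit [FiniteDimensional ℝ E] in
theorem IsVelocity.exists_curve {H : Subgroup G} {X : GroupLieAlgebra 𝓘(ℝ, E) G}
    (hX : IsVelocity E H X) : ∃ γ : ℝ → G, (∀ t, γ t ∈ H) ∧ γ 0 = 1 ∧
      HasMFDerivAt 𝓘(ℝ, ℝ) 𝓘(ℝ, E) γ 0
        (ContinuousLinearMap.toSpanSingleton ℝ (X : E) : ℝ →L[ℝ] E) := by
  obtain ⟨γ, hγ, h0, hH, hX⟩ := hX
  refine ⟨γ, hH, h0, ((hγ.mdifferentiable (by simp) 0).hasMFDerivAt).congr_mfderiv ?_⟩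
  have h : ∀ (A : ℝ →L[ℝ] E) (Y : E), A 1 = Y → A = ContinuousLinearMap.toSpanSingleton ℝ Y := by
    rintro A Y rfl
    ext
    simp
  exact h _ _ hX

variable [LieGroup 𝓘(ℝ, E) ∞ G]

/-- Differentiate the constant function `t ↦ β(Ad(γ t) y, Ad(γ t) z)` at `0`. Invariance is asked
only along `γ`, so the lemma serves both bi-invariant forms and forms invariant under `H`. -/
theorem skew_of_invariant_along (β : E →ₗ[ℝ] E →ₗ[ℝ] ℝ) {γ : ℝ → G} {X : E}
    (hγ : HasMFDerivAt 𝓘(ℝ, ℝ) 𝓘(ℝ, E) γ 0 (ContinuousLinearMap.toSpanSingleton ℝ X : ℝ →L[ℝ] E))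
    (h0 : γ 0 = 1) {y z : E} {c : ℝ}
    (hinv : ∀ t, β (adOrbit G y (γ t)) (adOrbit G z (γ t)) = c) :
    β (modelLie G X y) z + β y (modelLie G X z) = 0 := by
  have h1 := hasDerivAt_bilinear β (hasDerivAt_adOrbit hγ h0 y) (hasDerivAt_adOrbit hγ h0 z)
  have h2 : ∀ w : E, adOrbit G w (γ 0) = w := fun w => by
    rw [h0]; unfold adOrbit; rw [Ad_one]; rfl
  simp only [hinv, h2] at h1
  exact h1.unique (hasDerivAt_const (0 : ℝ) c)

variable {H : Subgroup G} {Q : LinearMap.BilinForm ℝ (GroupLieAlgebra 𝓘(ℝ, E) G)}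

theorem IsBiInvariantInner.skew (hQ : IsBiInvariantInner E Q)
    (x y z : GroupLieAlgebra 𝓘(ℝ, E) G) : Q ⁅x, y⁆ z + Q y ⁅x, z⁆ = 0 := by
  obtain ⟨γ, h0, hγ⟩ := HomogeneousMetric.exists_curve (G := G) (E := E) x
  exact skew_of_invariant_along (E := E) Q hγ h0 (c := Q y z) fun t => hQ.inv (γ t) y z

theorem proj_eq_zero_iff (hQ : IsBiInvariantInner E Q) (h : GroupLieAlgebra 𝓘(ℝ, E) G) :
    proj E H hQ h = 0 ↔ IsVelocity E H h :=
  Submodule.projectionOnto_apply_eq_zero_iff _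

/-- For a curve in `H` with velocity `h`, the orbit `Ad(γ t) y` stays in `𝔭`, hence so does its
derivative `[h, y]`. -/
theorem lie_mem_complement (hQ : IsBiInvariantInner E Q) {h y : GroupLieAlgebra 𝓘(ℝ, E) G}
    (hh : IsVelocity E H h) (hy : y ∈ complement E H Q) : ⁅h, y⁆ ∈ complement E H Q := by
  intro x hx
  obtain ⟨γ, hH, h0, hγ⟩ := hh.exists_curve
  have h1 := hasDerivAt_adOrbit hγ h0 y
  let φ : E →L[ℝ] ℝ := LinearMap.toContinuousLinearMap (Q x : E →ₗ[ℝ] ℝ)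
  have h2 := φ.hasFDerivAt.comp_hasDerivAt 0 h1
  have h3 : (φ ∘ fun t => adOrbit G y (γ t)) = fun _ => (0 : ℝ) := by
    funext t
    exact Ad_mem_complement E H hQ ⟨γ t, hH t⟩ y hy x hx
  rw [h3] at h2
  exact h2.unique (hasDerivAt_const (0 : ℝ) (0 : ℝ))

theorem isReductive_proj (hQ : IsBiInvariantInner E Q) : IsReductive (proj E H hQ) where
  proj_coe y := Submodule.projectionOnto_apply_left _ y
  coe_lie h hh y := by
    have := lie_mem_complement hQ ((proj_eq_zero_iff hQ h).1 hh) y.2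
    exact congrArg Subtype.val
      (Submodule.projectionOnto_apply_left (isCompl_complement E H hQ) ⟨_, this⟩)
  -- Unimodularity: `ad x` is skew for `Q` and hence traceless.
  trace_ad x := by
    obtain ⟨b, hb⟩ := exists_orthonormalFor hQ.symm hQ.pos
    rw [hb.trace_eq]
    refine Finset.sum_eq_zero fun i _ => ?_
    have := hQ.skew x (b i) (b i)
    rw [hQ.symm (b i)] at this
    rw [LieAlgebra.ad_apply]
    linarith

theorem isAdInvariantInner_proj (hQ : IsBiInvariantInner E Q) :
    IsAdInvariantInner (proj E H hQ) Q where
  symm := hQ.symm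
  pos := hQ.pos
  skew := hQ.skew
  orthogonal h hh y := y.2 h ((proj_eq_zero_iff hQ h).1 hh)

theorem isKerSkew_proj (hQ : IsBiInvariantInner E Q)
    {β : LinearMap.BilinForm ℝ (complement E H Q)}
    (hβ : ∀ k x y, β (isotropy E H hQ k x) (isotropy E H hQ k y) = β x y) :
    IsKerSkew (proj E H hQ) β := by
  intro h hh x y
  obtain ⟨γ, hH, h0, hγ⟩ := ((proj_eq_zero_iff hQ h).1 hh).exists_curve
  have hp : ∀ z : complement E H Q, proj E H hQ z = z := (isReductive_proj hQ).proj_coe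
  -- A form on `𝔭` is extended to the whole Lie algebra by the projection, so that brackets can be
  -- inserted before projecting.
  have h1 := skew_of_invariant_along (E := E) (β.compl₁₂ (proj E H hQ) (proj E H hQ)) hγ h0
    (y := (x : GroupLieAlgebra 𝓘(ℝ, E) G)) (z := (y : GroupLieAlgebra 𝓘(ℝ, E) G)) (c := β x y) ?_
  · have h2 : β (proj E H hQ ⁅h, (x : GroupLieAlgebra 𝓘(ℝ, E) G)⁆) (proj E H hQ y)
      + β (proj E H hQ x) (proj E H hQ ⁅h, (y : GroupLieAlgebra 𝓘(ℝ, E) G)⁆) = 0 := h1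
    rwa [hp, hp] at h2
  · intro t
    have h2 := hβ ⟨γ t, hH t⟩ x y
    rw [← hp (isotropy E H hQ _ x), ← hp (isotropy E H hQ _ y)] at h2
    exact h2

variable (E) in
/-- The adjoint operators as automorphisms of the Lie algebra. -/
def adEquiv (a : G) : GroupLieAlgebra 𝓘(ℝ, E) G ≃ₗ⁅ℝ⁆ GroupLieAlgebra 𝓘(ℝ, E) G where
  toLinearMap := Ad E a
  map_lie' := adOrbit_modelLie (E := E) a _ _
  invFun := Ad E a⁻¹
  left_inv x := by
    change (Ad E a⁻¹ ∘ₗ Ad E a) x = x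
    rw [← Ad_mul, inv_mul_cancel, Ad_one]
    rfl
  right_inv x := by
    change (Ad E a ∘ₗ Ad E a⁻¹) x = x
    rw [← Ad_mul, mul_inv_cancel, Ad_one]
    rfl

theorem killingForm_Ad (a : G) (x y : GroupLieAlgebra 𝓘(ℝ, E) G) :
    killingForm ℝ _ (Ad E a x) (Ad E a y) = killingForm ℝ _ x y :=
  LieAlgebra.killingForm_of_equiv_apply (adEquiv E a) x y

end LieGroupReductive

/-! ### Decompositions into pairwise non-isomorphic summands, and trivial representations. -/

section Schur

variable {K : Type*} [Group K] {V : Type*} [AddCommGroup V] [Module ℝ V] [FiniteDimensional ℝ V]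
  {ρ : Representation ℝ K V} {g : LinearMap.BilinForm ℝ V}

namespace Decomposition

/-- If the summands are pairwise non-isomorphic, invariant symmetric forms are diagonal. -/
theorem exists_forall_basis (hg : IsInvariantInner ρ g) (D : Decomposition ρ g)
    (hD : ∀ i j, i ≠ j → ¬ D.Isomorphic i j) {β : LinearMap.BilinForm ℝ V}
    (hs : ∀ x y, β x y = β y x) (hβ : ∀ k x y, β (ρ k x) (ρ k y) = β x y) :
    ∃ c : Fin D.q → ℝ, ∀ p r, β (D.basis p) (D.basis r) = if p = r then c p.1 else 0 := by
  choose c hc using fun i => exists_eq_mul_of_irreducible hg hs hβ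
    (fun k x hx => D.invariant i k x hx) (D.irreducible i)
  refine ⟨c, fun p r => ?_⟩
  obtain ⟨i, α⟩ := p
  obtain ⟨j, γ⟩ := r
  rw [basis_apply, basis_apply]
  by_cases hij : i = j
  · subst hij
    rw [hc i _ (D.e_mem i α) _ (D.e_mem i γ), D.orthonormal]
    simp
  · rw [D.eq_zero_of_not_isomorphic hg hβ (hD i j hij) _ (D.e_mem i α) _ (D.e_mem j γ), if_neg]
    rintro h
    exact hij (congrArg Sigma.fst h)

/-- Apply `exists_forall_basis` to the symmetric invariant form `g(B ·, ·)`. -/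
theorem exists_eq_diag (hg : IsInvariantInner ρ g) (D : Decomposition ρ g)
    (hD : ∀ i j, i ≠ j → ¬ D.Isomorphic i j) {B : V →ₗ[ℝ] V}
    (hB : ∀ x y, g (B x) y = g x (B y)) (heq : ∀ k x, B (ρ k x) = ρ k (B x)) :
    ∃ b, B = D.diag b := by
  obtain ⟨b, hb⟩ := D.exists_forall_basis hg hD (β := g ∘ₗ B)
    (fun x y => by
      rw [LinearMap.comp_apply, LinearMap.comp_apply, hB, hg.symm])
    (fun k x y => by
      rw [LinearMap.comp_apply, LinearMap.comp_apply, heq, hg.inv])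
  refine ⟨b, D.basis.ext fun p => ?_⟩
  rw [D.orthonormalFor_basis.eq_sum (B _), diag_basis, Finset.sum_eq_single p]
  · have h := hb p p
    rw [if_pos rfl] at h
    rw [← h]
    rfl
  · intro r _ hr
    have h := hb p r
    rw [if_neg hr.symm] at h
    change g (B (D.basis p)) (D.basis r) • _ = _
    erw [h, zero_smul]
  · simp

omit [FiniteDimensional ℝ V] in
-- Every line is a submodule of a trivial representation, so irreducible summands are lines.
theorem d_eq_one_of_trivial (D : Decomposition ρ g) (hρ : ∀ k x, ρ k x = x) (i : Fin D.q) :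
    D.d i = 1 := by
  let α : Fin (D.d i) := ⟨0, D.d_pos i⟩
  have hne : D.e i α ≠ 0 := by
    intro h
    have := D.orthonormal i α α
    simp [h] at this
  have h1 : Submodule.span ℝ {D.e i α} = D.P i := by
    refine (D.irreducible i _ ?_ fun k x hx => by rwa [hρ]).resolve_left ?_
    · rw [Submodule.span_singleton_le_iff_mem]
      exact D.e_mem i α
    · rwa [Submodule.span_singleton_eq_bot]
  by_contra hd
  have hlt : 1 < D.d i := lt_of_le_of_ne (D.d_pos i) (Ne.symm hd)
  have h2 := D.e_mem i ⟨1, hlt⟩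
  rw [← h1, Submodule.mem_span_singleton] at h2
  obtain ⟨c, hc⟩ := h2
  have h3 := D.orthonormal i α ⟨1, hlt⟩
  have h4 := D.orthonormal i ⟨1, hlt⟩ ⟨1, hlt⟩
  rw [← hc] at h3 h4
  simp [α, D.orthonormal] at h3
  simp [h3] at h4

theorem isomorphic_of_trivial (D : Decomposition ρ g) (hρ : ∀ k x, ρ k x = x) (i j : Fin D.q) :
    D.Isomorphic i j := by
  have h1 : ∀ i, Module.finrank ℝ (D.P i) = D.d i := by
    intro i
    rw [← D.span_e, finrank_span_eq_card, Fintype.card_fin]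
    rw [Fintype.linearIndependent_iff]
    intro c hc r
    have := congrArg (fun x => g x (D.e i r)) hc
    simpa [D.orthonormal] using this
  refine ⟨LinearEquiv.ofFinrankEq _ _ (by rw [h1, h1, D.d_eq_one_of_trivial hρ,
    D.d_eq_one_of_trivial hρ]), fun k x => ?_⟩
  have h2 : (⟨ρ k x, D.invariant i k x x.2⟩ : D.P i) = x := Subtype.ext (hρ k x)
  exact (congrArg (fun z => ((LinearEquiv.ofFinrankEq _ _ _ z : D.P j) : V)) h2).trans (hρ k _).symm

omit [FiniteDimensional ℝ V] in
theorem finrank_eq_sum (D : Decomposition ρ g) : Module.finrank ℝ V = ∑ i, D.d i := by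
  rw [Module.finrank_eq_card_basis D.basis]
  simp

/-- A trivial representation of dimension at least two has no decomposition into pairwise
non-isomorphic irreducible summands. -/
theorem q_eq_zero_of_trivial (D : Decomposition ρ g) (hρ : ∀ k x, ρ k x = x)
    (hD : ∀ i j, i ≠ j → ¬ D.Isomorphic i j) (hV : Module.finrank ℝ V ≠ 1) : D.q = 0 := by
  by_contra hq
  let i : Fin D.q := ⟨0, Nat.pos_of_ne_zero hq⟩
  have huniv : (Finset.univ : Finset (Fin D.q)) = {i} := by
    ext j
    simp only [Finset.mem_univ, Finset.mem_singleton, true_iff]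
    by_contra hji
    exact hD j i hji (D.isomorphic_of_trivial hρ j i)
  refine hV ?_
  rw [D.finrank_eq_sum, huniv, Finset.sum_singleton, D.d_eq_one_of_trivial hρ]

end Decomposition

end Schur

/-! ### Specialisation to the Lie group, and the exceptional case `F 1 = 0`. -/

section DiagonalScalarCurvature

variable {E : Type*} [NormedAddCommGroup E] [NormedSpace ℝ E] [FiniteDimensional ℝ E]
  {G : Type*} [TopologicalSpace G] [ChartedSpace E G] [Group G] [LieGroup 𝓘(ℝ, E) ∞ G]
  {H : Subgroup G} {Q : LinearMap.BilinForm ℝ (GroupLieAlgebra 𝓘(ℝ, E) G)}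

theorem S_deform_diag (hQ : IsBiInvariantInner E Q)
    {g : LinearMap.BilinForm ℝ (complement E H Q)} (hg : IsInvariantInner (isotropy E H hQ) g)
    (D : Decomposition (isotropy E H hQ) g) (a : Fin D.q → ℝ) :
    S E H hQ (deform g (D.diag a)) = D.diagScalar (proj E H hQ) a :=
  D.scalarCurvature_deform_diag (isReductive_proj hQ) hg (fun _ hβ => isKerSkew_proj hQ hβ)
    (fun k x y => killingForm_Ad (E := E) (k : G) x y) a

/-- If `F` annihilates the constant vector, then `G/H` is a flat torus. -/
theorem isotropy_trivial_of_mulVec_one_eq_zero [ConnectedSpace G] (hQ : IsBiInvariantInner E Q)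
    {g : LinearMap.BilinForm ℝ (complement E H Q)} (hg : IsInvariantInner (isotropy E H hQ) g)
    (D : Decomposition (isotropy E H hQ) g) (hD : ∀ i j, i ≠ j → ¬ D.Isomorphic i j)
    (h0 : (D.matrixF (proj E H hQ)).mulVec 1 = 0) (k : H) (x : complement E H Q) :
    isotropy E H hQ k x = x := by
  obtain ⟨y, hy⟩ := D.exists_forall_basis hg hD (β := Q.restrict (complement E H Q))
    (fun x y => hQ.symm x y) (fun k x y => hQ.inv (k : G) x y)
  -- By homogeneity `F 1` is minus the full gradient, so stationarity holds also in directions that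
  -- change the volume.
  have hgrad : ∀ b, D.diagGrad (proj E H hQ) 0 b = 0 := by
    intro b
    rw [← neg_eq_zero, ← D.diagHess_one, D.diagHess_eq, h0, dotProduct_zero]
  have hc := D.central_of_diagGrad_eq_zero (isAdInvariantInner_proj hQ) (isReductive_proj hQ) hg
    (fun k x y => killingForm_Ad (E := E) (k : G) x y) hy hgrad x
  exact Subtype.ext (adOrbit_eq_of_central (E := E) hc (k : G))

end DiagonalScalarCurvature

end HomogeneousMetric

end

/-! ### The theorem. -/

open HomogeneousMetric in
theorem theorem1 {E : Type*} [NormedAddCommGroup E] [NormedSpace ℝ E] [FiniteDimensional ℝ E]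
    {G : Type*} [TopologicalSpace G] [ChartedSpace E G] [Group G] [LieGroup 𝓘(ℝ, E) ∞ G]
    [T2Space G] [CompactSpace G] [ConnectedSpace G]
    (H : Subgroup G) (hH : IsCompact (H : Set G)) (heff : IsAlmostEffective E H)
    (Q : LinearMap.BilinForm ℝ (GroupLieAlgebra 𝓘(ℝ, E) G)) (hQ : IsBiInvariantInner E Q)
    (v : ℝ) (g : LinearMap.BilinForm ℝ (complement E H Q))
    (hg : IsCriticalPoint (S E H hQ) (isotropy E H hQ) v g) :
    (IsDegenerateCriticalPoint (S E H hQ) (isotropy E H hQ) v g →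
      ∃ D : Decomposition (isotropy E H hQ) g, (D.matrixF (proj E H hQ)).det = 0) ∧
    (Module.finrank ℝ (complement E H Q) ≠ 1 →
      ∀ D : Decomposition (isotropy E H hQ) g,
        (∀ i j, i ≠ j → ¬ D.Isomorphic i j) →
        (D.matrixF (proj E H hQ)).det = 0 →
        IsDegenerateCriticalPoint (S E H hQ) (isotropy E H hQ) v g) := by
  have hinv := hg.1.1
  constructor
  · rintro ⟨-, A, hA, hA0, hker⟩
    -- The decomposition is adapted to the degenerate direction `A`, which becomes diagonal in it.
    obtain ⟨D, a, ha⟩ := exists_decomposition hinv hA.symm hA.equivariant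
    obtain rfl : A = D.diag a := D.eq_diag ha
    refine ⟨D, D.det_matrixF_eq_zero (S_deform_diag hQ hinv D) hg (a := a) ?_ ?_ hker⟩
    · rintro rfl
      exact hA0 D.diag_zero
    · exact (D.trace_diag a).symm.trans hA.trace_eq_zero
  · intro hdim D hD hdet
    refine D.isDegenerateCriticalPoint (S_deform_diag hQ hinv D) hg
      (fun B hB => D.exists_eq_diag hinv hD hB.symm hB.equivariant) (fun h0 => ?_) hdet
    -- If `F 1 = 0` the isotropy representation is trivial; non-isomorphic summands and dimension
    -- different from `1` then leave no summand at all, and the empty determinant equals `1`.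
    have hq := D.q_eq_zero_of_trivial
      (isotropy_trivial_of_mulVec_one_eq_zero hQ hinv D hD h0) hD hdim
    have : IsEmpty (Fin D.q) := by rw [hq]; infer_instance
    rw [Matrix.det_isEmpty] at hdet
    exact one_ne_zero hdet
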